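/- Fix a set of action names. A (finite) \emph{probabilistic automaton} is a tuple $\mathcal A=(S,\bar s,\Sigma,D)$, where $S$ is a finite set of states, $\bar s\in S$ is the start state, $\Sigma=\mathtt H\uplus\mathtt E$ is a countable set of action names divided into internal actions $\mathtt H$ and external actions $\mathtt E$, and $D\subseteq S\times\Sigma\times \mathrm{Disc}(S)$ is a finite set of transitions ($\mathrm{Disc}(S)$ is the set of probability distributions on $S$). A \emph{cost probabilistic automaton} (CPA) is a probabilistic automaton together with a function $c\colon D\to\mathbb R_{\ge 0}$. Write $s\xrightarrow{a}\mu$ for $(s,a,\mu)\in D$, $D(a)$ for the set of transitions labelled by $a$, and $\mu_{tr}$ for the target distribution of a transition $tr$. The trace of an action $a$ is $\mathrm{tr}(a)=a$ if $a\in\mathtt E$ and the empty word if $a\in\mathtt H$. A \emph{finite execution fragment} is a sequence $\alpha=s_0a_1s_1\dots a_ns_n$ such that for each $i\ge 1$ there is $s_{i-1}\xrightarrow{a_i}\mu_i$ with $\mu_i(s_i)>0$; its trace is the concatenation $\mathrm{tr}(a_1)\cdots\mathrm{tr}(a_n)$, and $\mathrm{last}(\alpha)=s_n$. A \emph{scheduler}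 $\sigma$ assigns to each finite execution fragment $\alpha$ a sub-probability distribution $\sigma(\alpha)$ on the transitions in $D$ with source $\mathrm{last}(\alpha)$; put $\sigma(\alpha)(\bot)=1-\sigma(\alpha)(D)$. For a state $s$, define $p_{\sigma,s}(C_t)=1$ if $t=s$ and $0$ for the other states $t$, then $p_{\sigma,s}(C_{\alpha a t})=p_{\sigma,s}(C_\alpha)\cdot\sum_{tr\in D(a)}\sigma(\alpha)(tr)\,\mu_{tr}(t)$, and $p_{\sigma,s}(\alpha)=p_{\sigma,s}(C_\alpha)\cdot\sigma(\alpha)(\bot)$. The scheduler $\sigma$ \emph{induces} the weak combined transition $s\stackrel{a}{\Longrightarrow}\mu$ if $\sum_\alpha p_{\sigma,s}(\alpha)=1$, every $\alpha$ with $p_{\sigma,s}(\alpha)>0$ has trace $\mathrm{tr}(a)$, and $\sum_{\alpha:\,\mathrm{last}(\alpha)=t}p_{\sigma,s}(\alpha)=\mu(t)$ for every state $t$. The \emph{cost} of this weak combined transition (with respect to $\sigma$) is $\sum_\alpha c_\sigma(\alpha)\,p_{\sigma,s}(\alpha)\in[0,\infty]$, where $c_\sigma(t)=0$ for a state $t$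 and $$c_\sigma(\alpha a t)=c_\sigma(\alpha)+\sum_{tr\in D(a)}c(tr)\,\frac{\sigma(\alpha)(tr)\,\mu_{tr}(t)}{\sum_{tr'\in D(a)}\sigma(\alpha)(tr')\,\mu_{tr'}(t)},$$ the last sum being read as $0$ if the denominator is $0$. For CPAs $\mathcal A_1,\mathcal A_2$, an equivalence relation $\mathcal R$ on the disjoint union $S_1\uplus S_2$ is a \emph{weak probabilistic cost-preserving bisimulation} if, whenever $s\mathrel{\mathcal R}t$ and $s\xrightarrow{a}\mu_s$ is a transition of the automaton of $s$, there are a distribution $\mu_t$ and a scheduler of the automaton of $t$ that induces $t\stackrel{a}{\Longrightarrow}\mu_t$ with cost equal to the cost of $s\xrightarrow{a}\mu_s$ and such that $\mu_s$ and $\mu_t$ are related by the lifting of $\mathcal R$, i.e. there is $w\colon (S_1\uplus S_2)^2\to[0,1]$ with marginals $\mu_s$ and $\mu_t$ and with $x\mathrel{\mathcal R}y$ whenever $w(x,y)>0$. (Here $\mathrm{tr}(a)$ is taken in the automaton of $s$, and traces of fragments in the automaton of $t$; an internal $a$ need not be an action of the automaton of $t$.) $\mathcal A_1$ and $\mathcal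 A_2$ are \emph{weak probabilistic cost-preserving bisimilar}, $\mathcal A_1\approx_p\mathcal A_2$, if there is such an $\mathcal R$ with $\bar s_1\mathrel{\mathcal R}\bar s_2$. \textbf{Proposition.} Weak probabilistic cost-preserving bisimilarity $\approx_p$ is an equivalence relation on the CPAs, that is, it is reflexive, symmetric and transitive. -/

import Mathlib

open scoped ENNReal NNReal

universe u v

/-- A finite probabilistic automaton with actions taken from an ambient type `Act`.  Its set of
actions is `hidden ∪ external`; every automaton carries its own division of its actions into
hidden (internal) and external ones. -/
structure PA (Act : Type u) where
  State : Type v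
  finite_state : Finite State
  start : State
  hidden : Set Act
  external : Set Act
  disjoint_hidden_external : Disjoint hidden external
  countable_actions : (hidden ∪ external).Countable
  D : Set (State × Act × PMF State)
  finite_D : D.Finite
  action_mem : ∀ tr ∈ D, tr.2.1 ∈ hidden ∪ external

/-- A finite alternating sequence `s₀ a₁ s₁ ⋯ aₙ sₙ` of states and actions. -/
inductive AltSeq (S : Type v) (Act : Type u) : Type (max u v)
  | single (s : S) : AltSeq S Act
  | snoc (α : AltSeq S Act) (a : Act) (t : S) : AltSeq S Act

/-- The last state of a finite alternating sequence. -/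
def AltSeq.last {S : Type v} {Act : Type u} : AltSeq S Act → S
  | single s => s
  | snoc _ _ t => t

namespace PA

variable {Act : Type u}

/-- The source state of a transition. -/
def src {A : PA.{u, v} Act} (tr : A.D) : A.State := tr.1.1

/-- The action labelling a transition. -/
def act {A : PA.{u, v} Act} (tr : A.D) : Act := tr.1.2.1

/-- The target distribution of a transition. -/
def tgt {A : PA.{u, v} Act} (tr : A.D) : PMF A.State := tr.1.2.2

/-- The set `D(a)` of the transitions labelled by `a`. -/
def DAct (A : PA.{u, v} Act) (a : Act) : Set A.D := {tr | act tr = a}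

open Classical in
/-- The trace of an action: `a` itself if `a` is external, the empty trace otherwise. -/
noncomputable def actTrace (A : PA.{u, v} Act) (a : Act) : List Act :=
  if a ∈ A.external then [a] else []

/-- The sequence is an execution fragment: each step is a positive probability branch of some
transition. -/
def IsFrag (A : PA.{u, v} Act) : AltSeq A.State Act → Prop
  | .single _ => True
  | .snoc α a t => A.IsFrag α ∧ ∃ μ : PMF A.State, (α.last, a, μ) ∈ A.D ∧ 0 < μ t

/-- The finite execution fragments of `A`. -/
abbrev FinFrag (A : PA.{u, v} Act) : Type (max u v) := {α : AltSeq A.State Act // A.IsFrag α}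

/-- The last state of a finite execution fragment. -/
def FinFrag.last {A : PA.{u, v} Act} (α : A.FinFrag) : A.State := α.1.last

/-- The trace of an alternating sequence: its subsequence of external actions. -/
noncomputable def trace (A : PA.{u, v} Act) : AltSeq A.State Act → List Act
  | .single _ => []
  | .snoc α a _ => A.trace α ++ A.actTrace a

/-- A scheduler.  A discrete sub-probability distribution on `D`, together with its missing
mass at the extra point `⊥`, is a probability distribution on `Option D`, with `none` for `⊥`. -/
structure Scheduler (A : PA.{u, v} Act) where
  choice : A.FinFrag → PMF (Option A.D)
  source_eq : ∀ (α : A.FinFrag) (tr : A.D), 0 < choice α (some tr) → src tr = α.last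

/-- The probability that, after `α`, the scheduler chooses an `a`-labelled transition and that
the chosen transition leads to `t`. -/
noncomputable def Scheduler.stepProb {A : PA.{u, v} Act} (σ : A.Scheduler) (α : A.FinFrag)
    (a : Act) (t : A.State) : ℝ≥0∞ :=
  ∑' tr : A.DAct a, σ.choice α (some tr.1) * tgt tr.1 t

open Classical in
/-- The probability of the cone of a finite execution fragment under `σ` from `s`, by recursion
on the underlying sequence. -/
noncomputable def Scheduler.coneProbAux {A : PA.{u, v} Act} (σ : A.Scheduler) (s : A.State) :
    (α : AltSeq A.State Act) → A.IsFrag α → ℝ≥0∞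
  | .single t, _ => if t = s then 1 else 0
  | .snoc α a t, h => σ.coneProbAux s α h.1 * σ.stepProb ⟨α, h.1⟩ a t

/-- The probability of the cone of a finite execution fragment under `σ` from `s`. -/
noncomputable def Scheduler.coneProb {A : PA.{u, v} Act} (σ : A.Scheduler) (s : A.State)
    (α : A.FinFrag) : ℝ≥0∞ := σ.coneProbAux s α.1 α.2

/-- The probability of executing exactly `α` and then stopping. -/
noncomputable def Scheduler.fragProb {A : PA.{u, v} Act} (σ : A.Scheduler) (s : A.State)
    (α : A.FinFrag) : ℝ≥0∞ := σ.coneProb s α * σ.choice α none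

/-- `σ` induces, from `s`, a weak combined transition with observable trace `w` to the
distribution `μ`.  A weak combined transition labelled by the action `a` is one whose observable
trace is the trace of `a`.  There are countably many finite execution fragments, so the
probability of a set of them is the sum of the probabilities of its elements. -/
structure Scheduler.Induces {A : PA.{u, v} Act} (σ : A.Scheduler) (s : A.State)
    (w : List Act) (μ : PMF A.State) : Prop where
  finite_prob : ∑' α : A.FinFrag, σ.fragProb s α = 1
  trace_eq : ∀ α : A.FinFrag, 0 < σ.fragProb s α → A.trace α.1 = w
  last_prob : ∀ t : A.State, ∑' α : {α : A.FinFrag // α.last = t}, σ.fragProb s α.1 = μ t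

end PA

/-- A cost probabilistic automaton. -/
structure CPA (Act : Type u) extends PA.{u, v} Act where
  cost : D → ℝ≥0

namespace CPA

variable {Act : Type u}

open Classical in
/-- The share of the transition `tr` in the `a`-labelled step from `α` to `t`. -/
noncomputable def share {A : CPA.{u, v} Act} (σ : A.toPA.Scheduler) (α : A.toPA.FinFrag)
    (t : A.State) (a : Act) (tr : A.D) : ℝ≥0∞ :=
  if 0 < σ.stepProb α a t then σ.choice α (some tr) * PA.tgt tr t / σ.stepProb α a t else 0

/-- The cost of a finite execution fragment under `σ`, by recursion on the underlying sequence. -/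
noncomputable def fragCostAux {A : CPA.{u, v} Act} (σ : A.toPA.Scheduler) :
    (α : AltSeq A.State Act) → A.toPA.IsFrag α → ℝ≥0∞
  | .single _, _ => 0
  | .snoc α a t, h => fragCostAux σ α h.1 +
      ∑' tr : A.toPA.DAct a, (A.cost tr.1 : ℝ≥0∞) * share σ ⟨α, h.1⟩ t a tr.1

/-- The cost of a finite execution fragment under `σ`. -/
noncomputable def fragCost {A : CPA.{u, v} Act} (σ : A.toPA.Scheduler) (α : A.toPA.FinFrag) :
    ℝ≥0∞ := fragCostAux σ α.1 α.2

/-- The cost of the weak combined transition that `σ` induces from `s`: the expected cost of the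
finite execution fragments.  The value `∞` is possible. -/
noncomputable def weakCost {A : CPA.{u, v} Act} (σ : A.toPA.Scheduler) (s : A.State) : ℝ≥0∞ :=
  ∑' α : A.toPA.FinFrag, fragCost σ α * σ.fragProb s α

/-- There is a transition from `s` labelled by an action with trace `w`, with target `μ` and
cost `c`. -/
def Step (A : CPA.{u, v} Act) (s : A.State) (w : List Act) (μ : PMF A.State) (c : ℝ≥0) : Prop :=
  ∃ tr : A.D, PA.src tr = s ∧ A.toPA.actTrace (PA.act tr) = w ∧ PA.tgt tr = μ ∧ A.cost tr = c

/-- There is a weak combined transition from `s` with trace `w` and target `μ` that is induced by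
a scheduler for which it has cost `c`. -/
def WeakStep (A : CPA.{u, v} Act) (s : A.State) (w : List Act) (μ : PMF A.State) (c : ℝ≥0) :
    Prop :=
  ∃ σ : A.toPA.Scheduler, σ.Induces s w μ ∧ weakCost σ s = c

/-- Transitions leaving a state of the disjoint union of the state sets of two automata. -/
def SumStep (A B : CPA.{u, v} Act) (w : List Act) (c : ℝ≥0) :
    A.State ⊕ B.State → PMF (A.State ⊕ B.State) → Prop
  | .inl s, ρ => ∃ μ : PMF A.State, A.Step s w μ c ∧ ρ = μ.map Sum.inl
  | .inr s, ρ => ∃ μ : PMF B.State, B.Step s w μ c ∧ ρ = μ.map Sum.inr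

/-- Weak combined transitions leaving a state of the disjoint union of the state sets of two
automata. -/
def SumWeakStep (A B : CPA.{u, v} Act) (w : List Act) (c : ℝ≥0) :
    A.State ⊕ B.State → PMF (A.State ⊕ B.State) → Prop
  | .inl s, ρ => ∃ μ : PMF A.State, A.WeakStep s w μ c ∧ ρ = μ.map Sum.inl
  | .inr s, ρ => ∃ μ : PMF B.State, B.WeakStep s w μ c ∧ ρ = μ.map Sum.inr

/-- The lifting of a relation to probability distributions by means of a weighting function.
The marginal conditions force the values of `w` to lie in `[0,1]`. -/
def LiftRel {X Y : Type v} (R : X → Y → Prop) (μ : PMF X) (ν : PMF Y) : Prop :=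
  ∃ w : X → Y → ℝ≥0∞, (∀ x y, 0 < w x y → R x y) ∧
    (∀ x, ∑' y, w x y = μ x) ∧ (∀ y, ∑' x, w x y = ν y)

/-- The equivalence relation `R` on the disjoint union of the state sets is a weak probabilistic
cost-preserving bisimulation.  The trace `w` is that of the challenging action, as classified by
the challenger's automaton; the defender has to produce it with its own external actions. -/
def IsWeakCostBisimulation (A B : CPA.{u, v} Act) (R : Setoid (A.State ⊕ B.State)) : Prop :=
  ∀ s t : A.State ⊕ B.State, R s t → ∀ (w : List Act) (c : ℝ≥0) (μ : PMF (A.State ⊕ B.State)),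
    SumStep A B w c s μ → ∃ ν, SumWeakStep A B w c t ν ∧ LiftRel R μ ν

/-- Weak probabilistic cost-preserving bisimilarity. -/
def WeakCostBisimilar (A B : CPA.{u, v} Act) : Prop :=
  ∃ R : Setoid (A.State ⊕ B.State),
    IsWeakCostBisimulation A B R ∧ R (.inl A.start) (.inr B.start)

end CPA

/-! A bisimulation amounts to a pair of maps `h`, `k` from the two state sets into a common set,
with the relation as their joint kernel (`weakCostBisimilar_iff`); lifting such a relation means
equality of image distributions (`liftRel_iff_map_eq`). Reflexivity and symmetry are then immediate.
For transitivity, the two quotients are glued along the states of the middle automaton. Which weak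
combined transitions exist, up to images of their targets, is an invariant of the points of each
quotient, and it descends to the pushout. This requires that a bisimulation matches weak combined
transitions, although its definition only speaks of single ones (`IsWeakSimulation.weakStep`).

That lemma carries the analytic weight. Instead of composing schedulers, the proof composes flows:
masses on pairs of a sequence and a transition that satisfy a balance equation. Flows can be
averaged, started after a prefix and iterated infinitely often (`Flow.tsum`, `IsFlow.push`,
`Flow.iterate`). As every sequence has at most one predecessor, conditional probabilities turn a
flow from a unit mass back into a scheduler (`IsFlow.exists_policy`). The cost of a flow is linear
in it. It agrees with the cost defined by averaging over executions because of
`tsum_seqCost_mul_haltProb`, where almost sure halting and the finiteness of `D` enter. -/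

open Filter Topology

/-! ### Sums over alternating sequences, graded by length -/

/-- The number of actions of a finite alternating sequence. -/
def AltSeq.length {S : Type v} {Act : Type u} : AltSeq S Act → ℕ
  | single _ => 0
  | snoc α _ _ => α.length + 1

/-- A finite alternating sequence is a state, or arises by adding a step to a shorter one. -/
def AltSeq.equivSum (S : Type v) (Act : Type u) :
    AltSeq S Act ≃ S ⊕ (AltSeq S Act × Act × S) where
  toFun
    | single s => .inl s
    | snoc α a t => .inr (α, a, t)
  invFun
    | .inl s => single s
    | .inr (α, a, t) => snoc α a t
  left_inv α := by cases α <;> rfl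
  right_inv x := by rcases x with s | ⟨α, a, t⟩ <;> rfl

theorem AltSeq.tsum_eq {S : Type v} {Act : Type u} (f : AltSeq S Act → ℝ≥0∞) :
    ∑' α, f α = ∑' s, f (single s) + ∑' α, ∑' a, ∑' t, f (snoc α a t) := by
  rw [← (AltSeq.equivSum S Act).symm.tsum_eq,
    Summable.tsum_sum ENNReal.summable ENNReal.summable, ENNReal.tsum_prod']
  simp_rw [ENNReal.tsum_prod']
  rfl

theorem ENNReal.tsum_option {ι : Type*} (f : Option ι → ℝ≥0∞) :
    ∑' o, f o = f none + ∑' i, f (some i) := by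
  rw [← (Equiv.optionEquivSumPUnit.{0} ι).symm.tsum_eq,
    Summable.tsum_sum ENNReal.summable ENNReal.summable, add_comm]
  simp

open scoped Classical in
/-- The part of a sum over the finite alternating sequences that comes from those of length `n`. -/
noncomputable def AltSeq.levelSum {S : Type v} {Act : Type u} (n : ℕ)
    (f : AltSeq S Act → ℝ≥0∞) : ℝ≥0∞ :=
  ∑' α, if α.length = n then f α else 0

namespace AltSeq

variable {S : Type v} {Act : Type u}

theorem tsum_levelSum (f : AltSeq S Act → ℝ≥0∞) : ∑' n, levelSum n f = ∑' α, f α := by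
  simp only [levelSum]
  rw [ENNReal.tsum_comm]
  refine tsum_congr fun α => ?_
  simp_rw [eq_comm (a := α.length)]
  exact tsum_ite_eq _ _

/-- Every sequence of length `n + 1` extends exactly one of length `n`. This reduces identities
between consecutive times to pointwise ones. -/
theorem levelSum_succ (n : ℕ) (f : AltSeq S Act → ℝ≥0∞) :
    levelSum (n + 1) f = levelSum n fun α => ∑' a, ∑' t, f (snoc α a t) := by
  simp only [levelSum]
  rw [AltSeq.tsum_eq]
  simp only [length, Nat.right_eq_add, Nat.add_eq_zero_iff, one_ne_zero, and_false,
    if_false, tsum_zero, zero_add, Nat.add_right_cancel_iff]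
  refine tsum_congr fun α => ?_
  split_ifs <;> simp

theorem levelSum_add (n : ℕ) (f g : AltSeq S Act → ℝ≥0∞) :
    levelSum n (fun α => f α + g α) = levelSum n f + levelSum n g := by
  simp only [levelSum, ← ENNReal.tsum_add]
  exact tsum_congr fun α => by split_ifs <;> simp

theorem levelSum_mul_left (n : ℕ) (c : ℝ≥0∞) (f : AltSeq S Act → ℝ≥0∞) :
    levelSum n (fun α => c * f α) = c * levelSum n f := by
  simp only [levelSum, ← ENNReal.tsum_mul_left]
  exact tsum_congr fun α => by split_ifs <;> simp

theorem levelSum_mono {n : ℕ} {f g : AltSeq S Act → ℝ≥0∞}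
    (h : ∀ α, α.length = n → f α ≤ g α) : levelSum n f ≤ levelSum n g :=
  ENNReal.tsum_le_tsum fun α => by
    split_ifs with hα
    · exact h α hα
    · exact le_rfl

theorem levelSum_congr {n : ℕ} {f g : AltSeq S Act → ℝ≥0∞}
    (h : ∀ α, α.length = n → f α = g α) : levelSum n f = levelSum n g :=
  le_antisymm (levelSum_mono fun α hα => (h α hα).le) (levelSum_mono fun α hα => (h α hα).ge)

theorem levelSum_zero (f : AltSeq S Act → ℝ≥0∞) : levelSum 0 f = ∑' s, f (single s) := by
  simp only [levelSum]
  rw [AltSeq.tsum_eq]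
  simp [length]

end AltSeq

/-! ### Policies and almost sure halting -/

namespace PA

variable {Act : Type u}

open scoped Classical in
theorem tsum_act {A : PA.{u, v} Act} (f : A.D → A.State → ℝ≥0∞) :
    ∑' a, ∑' t, ∑' tr : A.D, (if act tr = a then f tr t else 0) = ∑' tr, ∑' t, f tr t := by
  calc _ = ∑' a, ∑' tr : A.D, ∑' t, (if act tr = a then f tr t else 0) :=
        tsum_congr fun a => ENNReal.tsum_comm
    _ = ∑' tr : A.D, ∑' a, ∑' t, (if act tr = a then f tr t else 0) := ENNReal.tsum_comm
    _ = _ := by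
      refine tsum_congr fun tr => ?_
      rw [tsum_eq_single (act tr) fun a ha => by simp [ha.symm]]
      simp

/-- A scheduler that is defined on all finite alternating sequences. -/
structure Policy (A : PA.{u, v} Act) where
  choice : AltSeq A.State Act → PMF (Option A.D)
  source_eq : ∀ α tr, choice α (some tr) ≠ 0 → src tr = α.last

namespace Policy

variable {A : PA.{u, v} Act} (κ : A.Policy)

open scoped Classical in
/-- The probability of an `a`-labelled step from `α` to `t`. -/
noncomputable def stepProb (α : AltSeq A.State Act) (a : Act) (t : A.State) : ℝ≥0∞ :=
  ∑' tr : A.D, if act tr = a then κ.choice α (some tr) * tgt tr t else 0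

open scoped Classical in
/-- The probability of the cone of a finite alternating sequence. -/
noncomputable def cone (s : A.State) : AltSeq A.State Act → ℝ≥0∞
  | .single t => if t = s then 1 else 0
  | .snoc α a t => cone s α * κ.stepProb α a t

/-- The probability of stopping after exactly the given finite alternating sequence. -/
noncomputable def haltProb (s : A.State) (α : AltSeq A.State Act) : ℝ≥0∞ :=
  κ.cone s α * κ.choice α none

theorem choice_none_add (α : AltSeq A.State Act) :
    κ.choice α none + ∑' tr, κ.choice α (some tr) = 1 := by
  rw [← ENNReal.tsum_option, PMF.tsum_coe]

theorem tsum_stepProb (α : AltSeq A.State Act) :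
    ∑' a, ∑' t, κ.stepProb α a t = ∑' tr, κ.choice α (some tr) := by
  simp only [stepProb]
  rw [tsum_act]
  simp [ENNReal.tsum_mul_left, PMF.tsum_coe]

theorem stepProb_le_one (α : AltSeq A.State Act) (a : Act) (t : A.State) :
    κ.stepProb α a t ≤ 1 :=
  calc κ.stepProb α a t ≤ ∑' t, κ.stepProb α a t := ENNReal.le_tsum t
    _ ≤ ∑' a, ∑' t, κ.stepProb α a t := ENNReal.le_tsum (f := fun a => ∑' t, κ.stepProb α a t) a
    _ = ∑' tr, κ.choice α (some tr) := κ.tsum_stepProb α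
    _ ≤ 1 := by rw [← κ.choice_none_add α]; exact le_add_self

/-- Conservation of mass: after `α` a policy either stops or takes one further step. -/
theorem cone_eq_haltProb_add (s : A.State) (α : AltSeq A.State Act) :
    κ.cone s α = κ.haltProb s α + ∑' a, ∑' t, κ.cone s (.snoc α a t) := by
  simp only [haltProb, cone, ENNReal.tsum_mul_left]
  rw [tsum_stepProb, ← mul_add, choice_none_add, mul_one]

theorem levelSum_cone_zero (s : A.State) : AltSeq.levelSum 0 (κ.cone s) = 1 := by
  classical
  rw [AltSeq.levelSum_zero]
  simp only [cone]
  exact tsum_ite_eq s _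

theorem levelSum_haltProb_add (s : A.State) (n : ℕ) :
    AltSeq.levelSum n (κ.haltProb s) + AltSeq.levelSum (n + 1) (κ.cone s) =
      AltSeq.levelSum n (κ.cone s) := by
  rw [AltSeq.levelSum_succ, ← AltSeq.levelSum_add]
  exact AltSeq.levelSum_congr fun α _ => (κ.cone_eq_haltProb_add s α).symm

theorem sum_levelSum_haltProb_add (s : A.State) (N : ℕ) :
    ∑ n ∈ Finset.range N, AltSeq.levelSum n (κ.haltProb s) + AltSeq.levelSum N (κ.cone s) = 1 := by
  induction N with
  | zero => simpa using κ.levelSum_cone_zero s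
  | succ N ih => rw [Finset.sum_range_succ, add_assoc, levelSum_haltProb_add, ih]

/-- If the policy stops with probability one, then the probability of taking at least `N` steps
tends to zero. -/
theorem tendsto_levelSum_cone {s : A.State} (h : ∑' α, κ.haltProb s α = 1) :
    Tendsto (fun N => AltSeq.levelSum N (κ.cone s)) atTop (𝓝 0) := by
  have h1 : Tendsto (fun N => ∑ n ∈ Finset.range N, AltSeq.levelSum n (κ.haltProb s)) atTop
      (𝓝 1) := by
    rw [← h, ← AltSeq.tsum_levelSum]
    exact ENNReal.tendsto_nat_tsum _
  have h2 : ∀ N, AltSeq.levelSum N (κ.cone s) =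
      1 - ∑ n ∈ Finset.range N, AltSeq.levelSum n (κ.haltProb s) := fun N => by
    refine ENNReal.eq_sub_of_add_eq ?_ ?_
    · refine ne_top_of_le_ne_top ENNReal.one_ne_top ?_
      rw [← κ.sum_levelSum_haltProb_add s N]
      exact le_self_add
    · rw [add_comm, sum_levelSum_haltProb_add]
  simp_rw [h2]
  simpa using ENNReal.Tendsto.sub (tendsto_const_nhds (x := (1 : ℝ≥0∞))) h1
    (Or.inl ENNReal.one_ne_top)

end Policy

end PA

/-! ### Expected cost as the sum of the costs of the chosen transitions -/

namespace CPA

open PA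

variable {Act : Type u} {A : CPA.{u, v} Act} (κ : A.toPA.Policy)

open scoped Classical in
/-- The expected cost of a step, given its action and its target state. -/
noncomputable def stepCost (α : AltSeq A.State Act) (a : Act) (t : A.State) : ℝ≥0∞ :=
  (∑' tr : A.D, if act tr = a then (A.cost tr : ℝ≥0∞) * (κ.choice α (some tr) * tgt tr t) else 0) /
    κ.stepProb α a t

/-- The expected cost of the steps of a finite alternating sequence. -/
noncomputable def seqCost : AltSeq A.State Act → ℝ≥0∞
  | .single _ => 0
  | .snoc α a t => seqCost α + stepCost κ α a t

/-- The expected cost of the transition that is chosen after `α`. -/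
noncomputable def choiceCost (α : AltSeq A.State Act) : ℝ≥0∞ :=
  ∑' tr : A.D, κ.choice α (some tr) * (A.cost tr : ℝ≥0∞)

/-- The division in `stepCost` is harmless: if the step has probability zero, every summand on the
right vanishes too. -/
theorem stepProb_mul_stepCost (α : AltSeq A.State Act) (a : Act) (t : A.State) :
    κ.stepProb α a t * stepCost κ α a t =
      open scoped Classical in
      ∑' tr : A.D, if act tr = a then (A.cost tr : ℝ≥0∞) * (κ.choice α (some tr) * tgt tr t)
        else 0 := by
  classical
  by_cases h : κ.stepProb α a t = 0
  · rw [h, zero_mul, eq_comm, ENNReal.tsum_eq_zero]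
    intro tr
    have h' := ENNReal.tsum_eq_zero.1 h tr
    split_ifs at h' ⊢ with htr
    · rw [h', mul_zero]
    · rfl
  · exact ENNReal.mul_div_cancel h
      (ne_top_of_le_ne_top ENNReal.one_ne_top (κ.stepProb_le_one α a t))

theorem tsum_stepProb_mul_stepCost (α : AltSeq A.State Act) :
    ∑' a, ∑' t, κ.stepProb α a t * stepCost κ α a t = choiceCost κ α := by
  simp only [stepProb_mul_stepCost, choiceCost]
  rw [tsum_act (A := A.toPA)]
  simp only [ENNReal.tsum_mul_left, PMF.tsum_coe, mul_one]
  exact tsum_congr fun tr => mul_comm _ _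

/-- A conditional average of transition costs is at most their total, which is finite because `D`
is. -/
theorem stepCost_le (α : AltSeq A.State Act) (a : Act) (t : A.State) :
    stepCost κ α a t ≤ ∑' tr : A.D, (A.cost tr : ℝ≥0∞) := by
  classical
  refine ENNReal.div_le_of_le_mul ?_
  rw [← ENNReal.tsum_mul_right]
  refine ENNReal.tsum_le_tsum fun tr => ?_
  split_ifs with h
  · gcongr
    refine le_trans ?_ (ENNReal.le_tsum tr)
    simp [h]
  · exact zero_le

theorem seqCost_le (α : AltSeq A.State Act) :
    seqCost κ α ≤ α.length * ∑' tr : A.D, (A.cost tr : ℝ≥0∞) := by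
  induction α with
  | single s => simp [seqCost]
  | snoc α a t ih =>
    simp only [seqCost, AltSeq.length, Nat.cast_add, Nat.cast_one, add_mul, one_mul]
    exact add_le_add ih (stepCost_le κ α a t)

theorem tsum_cost_ne_top : ∑' tr : A.D, (A.cost tr : ℝ≥0∞) ≠ ∞ := by
  have := A.finite_D.fintype
  rw [tsum_fintype]
  exact ENNReal.sum_ne_top.2 fun tr _ => ENNReal.coe_ne_top

theorem levelSum_seqCost_succ (s : A.State) (n : ℕ) :
    AltSeq.levelSum n (fun α => seqCost κ α * κ.haltProb s α) +
        AltSeq.levelSum (n + 1) (fun α => seqCost κ α * κ.cone s α) =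
      AltSeq.levelSum n (fun α => seqCost κ α * κ.cone s α) +
        AltSeq.levelSum n (fun α => κ.cone s α * choiceCost κ α) := by
  rw [AltSeq.levelSum_succ, ← AltSeq.levelSum_add, ← AltSeq.levelSum_add]
  refine AltSeq.levelSum_congr fun α _ => ?_
  have h : ∀ a t, seqCost κ (.snoc α a t) * κ.cone s (.snoc α a t) =
      seqCost κ α * κ.cone s (.snoc α a t) +
        κ.cone s α * (κ.stepProb α a t * stepCost κ α a t) := fun a t => by
    simp only [seqCost, Policy.cone]
    ring
  simp only [h, ENNReal.tsum_add, ENNReal.tsum_mul_left]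
  rw [tsum_stepProb_mul_stepCost, ← add_assoc, ← mul_add, ← κ.cone_eq_haltProb_add]

/-- Telescoping: the cost incurred before time `N` is split between the executions that have already
stopped and those still running. -/
theorem sum_levelSum_seqCost (s : A.State) (N : ℕ) :
    ∑ n ∈ Finset.range N, AltSeq.levelSum n (fun α => seqCost κ α * κ.haltProb s α) +
        AltSeq.levelSum N (fun α => seqCost κ α * κ.cone s α) =
      ∑ n ∈ Finset.range N, AltSeq.levelSum n (fun α => κ.cone s α * choiceCost κ α) := by
  induction N with
  | zero => simp [AltSeq.levelSum_zero, seqCost]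
  | succ N ih =>
    rw [Finset.sum_range_succ, add_assoc, levelSum_seqCost_succ, ← add_assoc, ih,
      Finset.sum_range_succ]

/-- The cost accumulated up to time `N` is bounded by the cost of the sequences of length at
least `N` after which the policy stops. -/
theorem levelSum_seqCost_mul_cone_le {s : A.State} (h : ∑' α, κ.haltProb s α = 1) (N : ℕ) :
    AltSeq.levelSum N (fun α => seqCost κ α * κ.cone s α) ≤
      ∑' m, AltSeq.levelSum (m + N) (fun α => seqCost κ α * κ.haltProb s α) := by
  -- `K` bounds `seqCost` on sequences of length `N`, so capping at `K` loses nothing at that level.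
  -- At later levels the cap bounds the cost of the running executions by `K` times a probability
  -- that tends to zero; without it there is no such bound a priori.
  set K : ℝ≥0∞ := N * ∑' tr : A.D, (A.cost tr : ℝ≥0∞) with hK
  have hK_top : K ≠ ∞ := ENNReal.mul_ne_top (ENNReal.natCast_ne_top N) tsum_cost_ne_top
  set F : AltSeq A.State Act → ℝ≥0∞ := fun α => min (seqCost κ α) K with hF
  have hstep : ∀ n, AltSeq.levelSum n (fun α => F α * κ.cone s α) ≤
      AltSeq.levelSum n (fun α => F α * κ.haltProb s α) +
        AltSeq.levelSum (n + 1) (fun α => F α * κ.cone s α) := fun n => by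
    rw [AltSeq.levelSum_succ, ← AltSeq.levelSum_add]
    refine AltSeq.levelSum_mono fun α _ => ?_
    rw [κ.cone_eq_haltProb_add, mul_add, ← ENNReal.tsum_mul_left]
    simp_rw [← ENNReal.tsum_mul_left]
    gcongr with a t
    -- Costs only grow along an extension, and so do capped costs.
    exact min_le_min_right _ le_self_add
  have hsum : ∀ M, AltSeq.levelSum N (fun α => F α * κ.cone s α) ≤
      ∑ m ∈ Finset.range M, AltSeq.levelSum (m + N) (fun α => F α * κ.haltProb s α) +
        AltSeq.levelSum (M + N) (fun α => F α * κ.cone s α) := fun M => by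
    induction M with
    | zero => simp
    | succ M ih =>
      refine ih.trans ?_
      rw [Finset.sum_range_succ, add_assoc, Nat.add_right_comm M 1 N]
      gcongr
      exact hstep (M + N)
  have hlim : Tendsto (fun M => K * AltSeq.levelSum (M + N) (κ.cone s)) atTop (𝓝 0) := by
    simpa using ENNReal.Tendsto.const_mul
      ((tendsto_add_atTop_iff_nat N).2 (κ.tendsto_levelSum_cone h)) (Or.inr hK_top)
  have hle : ∀ M, AltSeq.levelSum N (fun α => F α * κ.cone s α) ≤
      ∑' m, AltSeq.levelSum (m + N) (fun α => seqCost κ α * κ.haltProb s α) +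
        K * AltSeq.levelSum (M + N) (κ.cone s) := fun M => by
    refine (hsum M).trans (add_le_add ?_ ?_)
    · refine le_trans (Finset.sum_le_sum fun m _ => ?_) (ENNReal.sum_le_tsum (Finset.range M))
      refine AltSeq.levelSum_mono fun α _ => ?_
      gcongr
      exact min_le_left _ _
    · rw [← AltSeq.levelSum_mul_left]
      refine AltSeq.levelSum_mono fun α _ => ?_
      gcongr
      exact min_le_right _ _
  calc AltSeq.levelSum N (fun α => seqCost κ α * κ.cone s α)
      = AltSeq.levelSum N (fun α => F α * κ.cone s α) := by
        refine AltSeq.levelSum_congr fun α hα => ?_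
        rw [hF]
        simp only
        rw [min_eq_left]
        rw [hK, ← hα]
        exact seqCost_le κ α
    _ ≤ _ := by
        refine ge_of_tendsto' (x := atTop) ?_ hle
        simpa using Tendsto.const_add _ hlim

/-- For a policy that stops with probability one, the expected cost of the executions is the
expected sum of the costs of the chosen transitions. -/
theorem tsum_seqCost_mul_haltProb {s : A.State} (h : ∑' α, κ.haltProb s α = 1) :
    ∑' α, seqCost κ α * κ.haltProb s α = ∑' α, κ.cone s α * choiceCost κ α := by
  rw [← AltSeq.tsum_levelSum, ← AltSeq.tsum_levelSum (fun α => κ.cone s α * choiceCost κ α)]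
  apply le_antisymm
  · rw [ENNReal.tsum_eq_iSup_nat]
    refine iSup_le fun N => le_trans ?_ (ENNReal.sum_le_tsum (Finset.range N))
    rw [← sum_levelSum_seqCost]
    exact le_self_add
  · rw [ENNReal.tsum_eq_iSup_nat
      (f := fun n => AltSeq.levelSum n fun α => κ.cone s α * choiceCost κ α)]
    refine iSup_le fun N => ?_
    -- The series splits at `N`; its tail absorbs the cost of the executions still running at time
    -- `N`.
    rw [← sum_levelSum_seqCost, ← ENNReal.summable.sum_add_tsum_nat_add' (k := N)]
    gcongr
    exact levelSum_seqCost_mul_cone_le κ h N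

end CPA

/-! ### Passing between schedulers and policies -/

namespace PA

variable {Act : Type u} {A : PA.{u, v} Act}

theorem IsFrag.snoc_of_stepProb_ne_zero {κ : A.Policy} {α : AltSeq A.State Act} {a : Act}
    {t : A.State} (hα : A.IsFrag α) (h : κ.stepProb α a t ≠ 0) : A.IsFrag (.snoc α a t) := by
  classical
  obtain ⟨tr, htr⟩ : ∃ tr : A.D,
      (if act tr = a then κ.choice α (some tr) * tgt tr t else 0) ≠ 0 := by
    by_contra! hc
    exact h (ENNReal.tsum_eq_zero.2 hc)
  split_ifs at htr with ha
  · have hsrc := κ.source_eq α tr (left_ne_zero_of_mul htr)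
    refine ⟨hα, tgt tr, ?_, pos_iff_ne_zero.2 (right_ne_zero_of_mul htr)⟩
    rw [← hsrc, ← ha]
    exact tr.2
  · exact absurd rfl htr

/-- A policy only chooses transitions that leave the last state, so non-fragments carry no mass and
the subtype `FinFrag` can be dropped from all sums. -/
theorem Policy.isFrag_of_cone_ne_zero {κ : A.Policy} {s : A.State} {α : AltSeq A.State Act}
    (h : κ.cone s α ≠ 0) : A.IsFrag α := by
  induction α with
  | single t => trivial
  | snoc α a t ih =>
    exact (ih (left_ne_zero_of_mul h)).snoc_of_stepProb_ne_zero (right_ne_zero_of_mul h)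

/-- Sums over execution fragments are sums over alternating sequences. -/
theorem tsum_finFrag {f : AltSeq A.State Act → ℝ≥0∞} (hf : ∀ α, f α ≠ 0 → A.IsFrag α) :
    ∑' α : A.FinFrag, f α.1 = ∑' α, f α :=
  tsum_subtype_eq_of_support_subset (s := {α | A.IsFrag α}) fun α hα => hf α hα

/-- The policy agrees with the scheduler on the execution fragments. -/
def Policy.Extends (κ : A.Policy) (σ : A.Scheduler) : Prop :=
  ∀ α : A.FinFrag, σ.choice α = κ.choice α.1

namespace Policy.Extends

variable {κ : A.Policy} {σ : A.Scheduler}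

theorem stepProb_eq (h : κ.Extends σ) (α : A.FinFrag) (a : Act) (t : A.State) :
    σ.stepProb α a t = κ.stepProb α.1 a t := by
  classical
  simp only [Scheduler.stepProb, Policy.stepProb, h α]
  rw [tsum_subtype (A.DAct a) fun tr => κ.choice α.1 (some tr) * tgt tr t]
  rfl

theorem coneProb_eq (h : κ.Extends σ) (s : A.State) (α : A.FinFrag) :
    σ.coneProb s α = κ.cone s α.1 := by
  obtain ⟨α, hα⟩ := α
  induction α with
  | single t => rfl
  | snoc α a t ih =>
    simp only [Scheduler.coneProb, Scheduler.coneProbAux, Policy.cone]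
    rw [← ih hα.1, h.stepProb_eq]
    rfl

theorem fragProb_eq (h : κ.Extends σ) (s : A.State) (α : A.FinFrag) :
    σ.fragProb s α = κ.haltProb s α.1 := by
  simp only [Scheduler.fragProb, Policy.haltProb, h.coneProb_eq, h α]

end Policy.Extends

theorem Policy.isFrag_of_haltProb_ne_zero {κ : A.Policy} {s : A.State} {α : AltSeq A.State Act}
    (h : κ.haltProb s α ≠ 0) : A.IsFrag α :=
  Policy.isFrag_of_cone_ne_zero (left_ne_zero_of_mul h)

open scoped Classical in
/-- The policy that follows a scheduler on the execution fragments and stops elsewhere. -/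
noncomputable def Scheduler.toPolicy (σ : A.Scheduler) : A.Policy where
  choice α := if h : A.IsFrag α then σ.choice ⟨α, h⟩ else PMF.pure none
  source_eq α tr htr := by
    split_ifs at htr with h
    · exact σ.source_eq ⟨α, h⟩ tr (pos_iff_ne_zero.2 htr)
    · simp at htr

theorem Scheduler.toPolicy_extends (σ : A.Scheduler) : σ.toPolicy.Extends σ := fun α => by
  simp [Scheduler.toPolicy, α.2]

/-- The scheduler that follows a policy. -/
noncomputable def Policy.toScheduler (κ : A.Policy) : A.Scheduler where
  choice α := κ.choice α.1
  source_eq α tr htr := κ.source_eq α.1 tr htr.ne'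

theorem Policy.extends_toScheduler (κ : A.Policy) : κ.Extends κ.toScheduler := fun _ => rfl

open scoped Classical in
/-- The distribution of the last state under a mass function on alternating sequences. -/
noncomputable def lastMass {S : Type v} (q : AltSeq S Act → ℝ≥0∞) (t : S) : ℝ≥0∞ :=
  ∑' α, if α.last = t then q α else 0

theorem tsum_lastMass {S : Type v} (q : AltSeq S Act → ℝ≥0∞) : ∑' t, lastMass q t = ∑' α, q α := by
  classical
  simp only [lastMass]
  rw [ENNReal.tsum_comm]
  refine tsum_congr fun α => ?_
  simp_rw [eq_comm (a := α.last)]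
  exact tsum_ite_eq _ _

theorem tsum_mul_last {S : Type v} (q : AltSeq S Act → ℝ≥0∞) (f : S → ℝ≥0∞) :
    ∑' α, q α * f α.last = ∑' t, lastMass q t * f t := by
  classical
  simp only [lastMass, ← ENNReal.tsum_mul_right]
  rw [ENNReal.tsum_comm]
  refine tsum_congr fun α => ?_
  rw [tsum_eq_single α.last fun t ht => by simp [ht.symm]]
  simp

theorem le_lastMass {S : Type v} (q : AltSeq S Act → ℝ≥0∞) (α : AltSeq S Act) :
    q α ≤ lastMass q α.last := by
  classical
  refine le_trans ?_ (ENNReal.le_tsum α)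
  simp

/-- The mass function `q` on alternating sequences describes an outcome with trace `w` and final
distribution `μ`. -/
structure IsOutcome (A : PA.{u, v} Act) (q : AltSeq A.State Act → ℝ≥0∞) (w : List Act)
    (μ : PMF A.State) : Prop where
  trace_eq : ∀ α, q α ≠ 0 → A.trace α = w
  last_eq : ∀ t, lastMass q t = μ t

theorem IsOutcome.tsum_eq_one {q : AltSeq A.State Act → ℝ≥0∞} {w : List Act} {μ : PMF A.State}
    (h : A.IsOutcome q w μ) : ∑' α, q α = 1 := by
  rw [← tsum_lastMass, tsum_congr h.last_eq, PMF.tsum_coe]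

theorem Policy.Extends.induces_iff {κ : A.Policy} {σ : A.Scheduler} (h : κ.Extends σ)
    (s : A.State) (w : List Act) (μ : PMF A.State) :
    σ.Induces s w μ ↔ A.IsOutcome (κ.haltProb s) w μ := by
  classical
  have hlast : ∀ t, ∑' α : {α : A.FinFrag // α.last = t}, σ.fragProb s α.1 =
      lastMass (κ.haltProb s) t := fun t => by
    have h1 := tsum_subtype {α : A.FinFrag | α.last = t} (σ.fragProb s)
    refine h1.trans ?_
    rw [lastMass, ← tsum_finFrag (A := A)]
    · refine tsum_congr fun α => ?_
      rw [Set.indicator_apply, h.fragProb_eq]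
      rfl
    · intro α hα
      split_ifs at hα with hc
      · exact Policy.isFrag_of_haltProb_ne_zero hα
      · exact absurd rfl hα
  constructor
  · rintro ⟨-, h2, h3⟩
    refine ⟨fun α hα => ?_, fun t => by rw [← hlast, h3]⟩
    refine h2 ⟨α, Policy.isFrag_of_haltProb_ne_zero hα⟩ ?_
    rw [h.fragProb_eq]
    exact pos_iff_ne_zero.2 hα
  · intro ho
    refine ⟨?_, fun α hα => ?_, fun t => by rw [hlast, ho.last_eq]⟩
    · simp_rw [h.fragProb_eq]
      rw [tsum_finFrag fun α hα => Policy.isFrag_of_haltProb_ne_zero hα, ho.tsum_eq_one]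
    · rw [h.fragProb_eq] at hα
      exact ho.trace_eq α.1 hα.ne'

end PA

namespace CPA

open PA

variable {Act : Type u} {A : CPA.{u, v} Act}

theorem fragCost_eq {κ : A.toPA.Policy} {σ : A.toPA.Scheduler} (h : κ.Extends σ)
    (α : A.toPA.FinFrag) : fragCost σ α = seqCost κ α.1 := by
  classical
  obtain ⟨α, hα⟩ := α
  induction α with
  | single t => rfl
  | snoc α a t ih =>
    simp only [fragCost, fragCostAux, seqCost]
    congr 1
    · exact ih hα.1
    · rw [tsum_subtype (A.toPA.DAct a)
        fun tr => (A.cost tr : ℝ≥0∞) * share σ ⟨α, hα.1⟩ t a tr]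
      simp only [stepCost, div_eq_mul_inv, ← ENNReal.tsum_mul_right]
      refine tsum_congr fun tr => ?_
      rw [Set.indicator_apply]
      simp only [DAct, Set.mem_ofPred_eq, share, h.stepProb_eq, h _]
      by_cases htr : act tr = a
      · simp only [htr, if_true]
        by_cases h0 : κ.stepProb α a t = 0
        · have h1 := ENNReal.tsum_eq_zero.1 h0 tr
          simp only [htr, if_true] at h1
          simp [h0, h1]
        · rw [if_pos (pos_iff_ne_zero.2 h0), div_eq_mul_inv]
          simp only [mul_assoc]
      · simp [htr]

theorem weakCost_eq {κ : A.toPA.Policy} {σ : A.toPA.Scheduler} (h : κ.Extends σ)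
    {s : A.State} (hs : ∑' α, κ.haltProb s α = 1) :
    weakCost σ s = ∑' α, κ.cone s α * choiceCost κ α := by
  rw [← tsum_seqCost_mul_haltProb κ hs, weakCost]
  simp_rw [fragCost_eq h, h.fragProb_eq]
  exact tsum_finFrag fun α hα => Policy.isFrag_of_haltProb_ne_zero (right_ne_zero_of_mul hα)

/-- Weak combined transitions in terms of policies. -/
theorem weakStep_iff_policy (s : A.State) (w : List Act) (μ : PMF A.State) (c : ℝ≥0) :
    A.WeakStep s w μ c ↔ ∃ κ : A.toPA.Policy, A.toPA.IsOutcome (κ.haltProb s) w μ ∧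
      ∑' α, κ.cone s α * choiceCost κ α = c := by
  constructor
  · rintro ⟨σ, hσ, hc⟩
    have ho := (σ.toPolicy_extends.induces_iff s w μ).1 hσ
    exact ⟨σ.toPolicy, ho, by rw [← weakCost_eq σ.toPolicy_extends ho.tsum_eq_one, hc]⟩
  · rintro ⟨κ, ho, hc⟩
    exact ⟨κ.toScheduler, (κ.extends_toScheduler.induces_iff s w μ).2 ho, by
      rw [weakCost_eq κ.extends_toScheduler ho.tsum_eq_one, hc]⟩

end CPA

/-! ### Prefixing and inflow of mass -/

/-- Concatenation of alternating sequences; the first state of the second one is dropped. -/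
def AltSeq.append {S : Type v} {Act : Type u} (α : AltSeq S Act) : AltSeq S Act → AltSeq S Act
  | single _ => α
  | snoc β a t => snoc (α.append β) a t

open scoped Classical in
/-- The unit mass at an alternating sequence. -/
noncomputable def AltSeq.dirac {S : Type v} {Act : Type u} (β : AltSeq S Act) :
    AltSeq S Act → ℝ≥0∞ := fun α => if α = β then 1 else 0

open scoped Classical in
/-- The image of a mass function under prefixing with `β`. -/
noncomputable def AltSeq.push {S : Type v} {Act : Type u} (β : AltSeq S Act)
    (f : AltSeq S Act → ℝ≥0∞) (α : AltSeq S Act) : ℝ≥0∞ :=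
  ∑' γ, if β.append γ = α then f γ else 0

namespace AltSeq

variable {S : Type v} {Act : Type u}

theorem exists_of_push_ne_zero {β : AltSeq S Act} {f : AltSeq S Act → ℝ≥0∞} {α : AltSeq S Act}
    (h : β.push f α ≠ 0) : ∃ γ, β.append γ = α ∧ f γ ≠ 0 := by
  classical
  by_contra! hc
  refine h (ENNReal.tsum_eq_zero.2 fun γ => ?_)
  split_ifs with hγ
  · exact hc γ hγ
  · rfl

theorem tsum_push_mul (β : AltSeq S Act) (f g : AltSeq S Act → ℝ≥0∞) :
    ∑' α, β.push f α * g α = ∑' γ, f γ * g (β.append γ) := by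
  classical
  simp only [push, ← ENNReal.tsum_mul_right]
  rw [ENNReal.tsum_comm]
  refine tsum_congr fun γ => ?_
  rw [tsum_eq_single (β.append γ) fun α hα => by simp [hα.symm]]
  simp

theorem push_add (β : AltSeq S Act) (f g : AltSeq S Act → ℝ≥0∞) (α : AltSeq S Act) :
    β.push (fun γ => f γ + g γ) α = β.push f α + β.push g α := by
  simp only [push, ← ENNReal.tsum_add]
  exact tsum_congr fun γ => by split_ifs <;> simp

theorem push_tsum {ι : Type*} (β : AltSeq S Act) (f : ι → AltSeq S Act → ℝ≥0∞)
    (α : AltSeq S Act) : β.push (fun γ => ∑' i, f i γ) α = ∑' i, β.push (f i) α := by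
  simp only [push]
  rw [ENNReal.tsum_comm]
  exact tsum_congr fun γ => by split_ifs <;> simp

theorem push_mul_right (β : AltSeq S Act) (f : AltSeq S Act → ℝ≥0∞) (c : ℝ≥0∞)
    (α : AltSeq S Act) : β.push (fun γ => f γ * c) α = β.push f α * c := by
  simp only [push, ← ENNReal.tsum_mul_right]
  exact tsum_congr fun γ => by split_ifs <;> simp

theorem push_dirac_single (β : AltSeq S Act) (s : S) :
    β.push (dirac (single s)) = dirac β := by
  classical
  funext α
  rw [push, tsum_eq_single (single s) fun γ hγ => by simp [dirac, hγ]]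
  simp [dirac, append, eq_comm]

end AltSeq

namespace PA

variable {Act : Type u} {A : PA.{u, v} Act}

theorem trace_append (α β : AltSeq A.State Act) :
    A.trace (α.append β) = A.trace α ++ A.trace β := by
  induction β with
  | single t => simp [AltSeq.append, trace]
  | snoc β a t ih => simp [AltSeq.append, trace, ih]

open scoped Classical in
/-- The mass that arrives at an alternating sequence if the mass `Z α tr` is sent from `α` along
the transition `tr`. -/
noncomputable def inflow (Z : AltSeq A.State Act → A.D → ℝ≥0∞) : AltSeq A.State Act → ℝ≥0∞
  | .single _ => 0
  | .snoc α a t => ∑' tr : A.D, if act tr = a then Z α tr * tgt tr t else 0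

theorem inflow_tsum {ι : Type*} (Z : ι → AltSeq A.State Act → A.D → ℝ≥0∞)
    (α : AltSeq A.State Act) :
    inflow (fun β tr => ∑' i, Z i β tr) α = ∑' i, inflow (Z i) α := by
  cases α with
  | single s => simp [inflow]
  | snoc α a t =>
    simp only [inflow]
    rw [ENNReal.tsum_comm]
    refine tsum_congr fun tr => ?_
    split_ifs
    · rw [ENNReal.tsum_mul_right]
    · simp

theorem inflow_mul_left (c : ℝ≥0∞) (Z : AltSeq A.State Act → A.D → ℝ≥0∞)
    (α : AltSeq A.State Act) : inflow (fun β tr => c * Z β tr) α = c * inflow Z α := by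
  cases α with
  | single s => simp [inflow]
  | snoc α a t =>
    simp only [inflow, ← ENNReal.tsum_mul_left]
    exact tsum_congr fun tr => by split_ifs <;> simp [mul_assoc]

theorem inflow_snoc_le (Z : AltSeq A.State Act → A.D → ℝ≥0∞) (α : AltSeq A.State Act) (a : Act)
    (t : A.State) : inflow Z (.snoc α a t) ≤ ∑' tr, Z α tr := by
  refine ENNReal.tsum_le_tsum fun tr => ?_
  split_ifs
  · exact mul_le_of_le_one_right' (PMF.coe_le_one _ _)
  · exact zero_le

/-- Prefixing commutes with adding a last step. It sends all one-state sequences to `β`, but these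
receive no inflow. -/
theorem inflow_push (β : AltSeq A.State Act) (Z : AltSeq A.State Act → A.D → ℝ≥0∞)
    (α : AltSeq A.State Act) :
    inflow (fun α tr => β.push (fun γ => Z γ tr) α) α = β.push (inflow Z) α := by
  classical
  cases α with
  | single s =>
    rw [inflow, eq_comm, AltSeq.push, ENNReal.tsum_eq_zero]
    intro γ
    cases γ with
    | single t => simp [inflow]
    | snoc γ a t => simp [AltSeq.append]
  | snoc α a t =>
    have h0 : ∑' s, (if β.append (.single s) = .snoc α a t then inflow Z (.single s) else 0) = 0 :=
      ENNReal.tsum_eq_zero.2 fun s => by simp [inflow]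
    rw [AltSeq.push, AltSeq.tsum_eq, h0, zero_add]
    simp only [inflow, AltSeq.append, AltSeq.snoc.injEq]
    have h1 : ∀ γ : AltSeq A.State Act, (∑' (b : Act) (x : A.State),
        if β.append γ = α ∧ b = a ∧ x = t then
          ∑' tr : A.D, if act tr = b then Z γ tr * tgt tr x else 0 else 0) =
        if β.append γ = α then ∑' tr : A.D, if act tr = a then Z γ tr * tgt tr t else 0 else 0 := by
      intro γ
      rw [tsum_eq_single a fun b hb => by simp [hb], tsum_eq_single t fun x hx => by simp [hx]]
      simp
    simp only [h1]
    change _ = β.push (fun γ => ∑' tr : A.D, if act tr = a then Z γ tr * tgt tr t else 0) α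
    rw [AltSeq.push_tsum]
    refine tsum_congr fun tr => ?_
    split_ifs
    · rw [AltSeq.push_mul_right]
    · simp [AltSeq.push]

end PA

/-! ### Flows and their correspondence with policies -/

namespace CPA

open PA

variable {Act : Type u} {A : CPA.{u, v} Act}

/-- The mass function `Z` on pairs of an alternating sequence and a transition transports the
initial mass `p` to the final mass `q` at cost `c`. -/
structure IsFlow (A : CPA.{u, v} Act) (Z : AltSeq A.State Act → A.D → ℝ≥0∞)
    (p q : AltSeq A.State Act → ℝ≥0∞) (c : ℝ≥0∞) : Prop where
  source_eq : ∀ α tr, Z α tr ≠ 0 → src tr = α.last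
  balance : ∀ α, p α + inflow Z α = q α + ∑' tr, Z α tr
  cost_eq : ∑' α, ∑' tr : A.D, Z α tr * (A.cost tr : ℝ≥0∞) = c

/-- The mass `p` can be transported to the mass `q` at cost `c`. -/
def Flow (A : CPA.{u, v} Act) (p q : AltSeq A.State Act → ℝ≥0∞) (c : ℝ≥0∞) : Prop :=
  ∃ Z, A.IsFlow Z p q c

theorem Flow.refl (p : AltSeq A.State Act → ℝ≥0∞) : A.Flow p p 0 :=
  ⟨fun _ _ => 0, by simp, fun α => by cases α <;> simp [inflow], by simp⟩

/-- Weighted sums of flows are flows. -/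
theorem Flow.tsum {ι : Type*} {k : ι → ℝ≥0∞} {p q : ι → AltSeq A.State Act → ℝ≥0∞}
    {c : ι → ℝ≥0∞} (h : ∀ i, k i ≠ 0 → A.Flow (p i) (q i) (c i)) :
    A.Flow (fun α => ∑' i, k i * p i α) (fun α => ∑' i, k i * q i α) (∑' i, k i * c i) := by
  have h' : ∀ i, ∃ Z, k i ≠ 0 → A.IsFlow Z (p i) (q i) (c i) := fun i => by
    by_cases hi : k i = 0
    · exact ⟨fun _ _ => 0, fun h => absurd hi h⟩
    · obtain ⟨Z, hZ⟩ := h i hi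
      exact ⟨Z, fun _ => hZ⟩
  choose Z hZ using h'
  refine ⟨fun α tr => ∑' i, k i * Z i α tr, fun α tr htr => ?_, fun α => ?_, ?_⟩
  · obtain ⟨i, hi⟩ : ∃ i, k i * Z i α tr ≠ 0 := by
      by_contra! hc
      exact htr (ENNReal.tsum_eq_zero.2 hc)
    exact (hZ i (left_ne_zero_of_mul hi)).source_eq α tr (right_ne_zero_of_mul hi)
  · rw [inflow_tsum, ENNReal.tsum_comm, ← ENNReal.tsum_add, ← ENNReal.tsum_add]
    refine tsum_congr fun i => ?_
    rw [inflow_mul_left, ENNReal.tsum_mul_left, ← mul_add, ← mul_add]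
    by_cases hi : k i = 0
    · simp [hi]
    · rw [(hZ i hi).balance]
  · simp_rw [← ENNReal.tsum_mul_right]
    calc _ = ∑' α, ∑' i, ∑' tr : A.D, k i * Z i α tr * (A.cost tr : ℝ≥0∞) :=
          tsum_congr fun α => ENNReal.tsum_comm
      _ = ∑' i, ∑' α, ∑' tr : A.D, k i * Z i α tr * (A.cost tr : ℝ≥0∞) := ENNReal.tsum_comm
      _ = _ := by
        refine tsum_congr fun i => ?_
        simp_rw [mul_assoc, ENNReal.tsum_mul_left]
        by_cases hi : k i = 0
        · simp [hi]
        · rw [(hZ i hi).cost_eq]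

/-- Infinite composition of flows. -/
theorem Flow.iterate {x y : ℕ → AltSeq A.State Act → ℝ≥0∞} {c : ℕ → ℝ≥0∞}
    (h : ∀ n, A.Flow (x n) (fun α => y n α + x (n + 1) α) (c n))
    (hx : ∀ α, Tendsto (fun n => x n α) atTop (𝓝 0)) :
    A.Flow (x 0) (fun α => ∑' n, y n α) (∑' n, c n) := by
  choose Z hZ using h
  refine ⟨fun α tr => ∑' n, Z n α tr, fun α tr htr => ?_, fun α => ?_, ?_⟩
  · obtain ⟨n, hn⟩ : ∃ n, Z n α tr ≠ 0 := by
      by_contra! hc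
      exact htr (ENNReal.tsum_eq_zero.2 hc)
    exact (hZ n).source_eq α tr hn
  · rw [inflow_tsum, ENNReal.tsum_comm]
    -- The balance equations telescope, with the mass `x N` still in transit as remainder; pointwise
    -- convergence of it to zero is enough for the limit.
    have hsum : ∀ N, x 0 α + ∑ n ∈ Finset.range N, inflow (Z n) α =
        ∑ n ∈ Finset.range N, y n α + ∑ n ∈ Finset.range N, ∑' tr, Z n α tr + x N α := by
      intro N
      induction N with
      | zero => simp
      | succ N ih =>
        rw [Finset.sum_range_succ, ← add_assoc, ih, add_assoc _ (x N α), (hZ N).balance,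
          Finset.sum_range_succ, Finset.sum_range_succ]
        ring
    refine tendsto_nhds_unique
      (tendsto_const_nhds.add (ENNReal.tendsto_nat_tsum fun n => inflow (Z n) α)) ?_
    simp_rw [hsum]
    simpa using ((ENNReal.tendsto_nat_tsum fun n => y n α).add
      (ENNReal.tendsto_nat_tsum fun n => ∑' tr, Z n α tr)).add (hx α)
  · simp_rw [← ENNReal.tsum_mul_right]
    calc _ = ∑' α, ∑' n, ∑' tr : A.D, Z n α tr * (A.cost tr : ℝ≥0∞) :=
          tsum_congr fun α => ENNReal.tsum_comm
      _ = ∑' n, ∑' α, ∑' tr : A.D, Z n α tr * (A.cost tr : ℝ≥0∞) := ENNReal.tsum_comm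
      _ = _ := tsum_congr fun n => (hZ n).cost_eq

/-- A one-state sequence has no inflow, so all its mass is initial mass. -/
theorem IsFlow.eq_of_single_ne_zero {Z : AltSeq A.State Act → A.D → ℝ≥0∞}
    {q : AltSeq A.State Act → ℝ≥0∞} {c : ℝ≥0∞} {s t : A.State}
    (h : A.IsFlow Z (AltSeq.dirac (.single s)) q c)
    (ht : q (.single t) + ∑' tr, Z (.single t) tr ≠ 0) : t = s := by
  rw [← h.balance] at ht
  by_contra hts
  simp [AltSeq.dirac, inflow, hts] at ht

/-- A flow from a state can be started after any sequence that ends in this state. -/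
theorem IsFlow.push {Z : AltSeq A.State Act → A.D → ℝ≥0∞}
    {q : AltSeq A.State Act → ℝ≥0∞} {c : ℝ≥0∞} {β : AltSeq A.State Act}
    (h : A.IsFlow Z (AltSeq.dirac (.single β.last)) q c) :
    A.IsFlow (fun α tr => β.push (fun γ => Z γ tr) α) β.dirac (β.push q) c where
  source_eq α tr htr := by
    obtain ⟨γ, rfl, hγ⟩ := AltSeq.exists_of_push_ne_zero htr
    rw [h.source_eq γ tr hγ]
    cases γ with
    | single t =>
      -- `append` forgets the state `t`, so `t` has to be `β.last`; other one-state sequences carry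
      -- no mass.
      refine h.eq_of_single_ne_zero fun h0 => hγ ?_
      exact ENNReal.tsum_eq_zero.1 (add_eq_zero.1 h0).2 tr
    | snoc γ a t => rfl
  balance α := by
    rw [inflow_push, ← AltSeq.push_dirac_single β β.last, ← AltSeq.push_add, ← AltSeq.push_tsum,
      ← AltSeq.push_add]
    simp_rw [h.balance]
  cost_eq := by
    rw [ENNReal.tsum_comm, ← h.cost_eq, ENNReal.tsum_comm (f := fun α (tr : A.D) => Z α tr * _)]
    exact tsum_congr fun tr => AltSeq.tsum_push_mul β (fun γ => Z γ tr) fun _ => A.cost tr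

/-- The flow of a policy. -/
theorem isFlow_of_policy (κ : A.toPA.Policy) (s : A.State) :
    A.IsFlow (fun α tr => κ.cone s α * κ.choice α (some tr)) (AltSeq.dirac (.single s))
      (κ.haltProb s) (∑' α, κ.cone s α * choiceCost κ α) where
  source_eq α tr htr := κ.source_eq α tr (right_ne_zero_of_mul htr)
  balance α := by
    have h1 : κ.haltProb s α + ∑' tr, κ.cone s α * κ.choice α (some tr) = κ.cone s α := by
      rw [ENNReal.tsum_mul_left, Policy.haltProb, ← mul_add, κ.choice_none_add, mul_one]
    rw [h1]
    cases α with
    | single t => by_cases ht : t = s <;> simp [AltSeq.dirac, inflow, Policy.cone, ht]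
    | snoc α a t =>
      simp only [AltSeq.dirac, inflow, Policy.cone, Policy.stepProb, ← ENNReal.tsum_mul_left,
        reduceCtorEq, if_false, zero_add]
      exact tsum_congr fun tr => by split_ifs <;> simp [mul_assoc]
  cost_eq := by
    simp only [choiceCost, ← ENNReal.tsum_mul_left, mul_assoc]

/-- The policy of a flow. -/
theorem IsFlow.exists_policy {Z : AltSeq A.State Act → A.D → ℝ≥0∞}
    {q : AltSeq A.State Act → ℝ≥0∞} {c : ℝ≥0∞} {s : A.State}
    (h : A.IsFlow Z (AltSeq.dirac (.single s)) q c) :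
    ∃ κ : A.toPA.Policy, κ.haltProb s = q ∧ ∑' α, κ.cone s α * choiceCost κ α = c := by
  classical
  set F : AltSeq A.State Act → Option A.D → ℝ≥0∞ := fun α o => o.elim (q α) (Z α) with hF
  set P : AltSeq A.State Act → ℝ≥0∞ := fun α => ∑' o, F α o with hP
  have hPF : ∀ α, P α = q α + ∑' tr, Z α tr := fun α => ENNReal.tsum_option _
  -- `P α` is the mass passing through `α`. It cannot grow along a branch, since all of it comes
  -- from the unique predecessor.
  have hP_le : ∀ α, P α ≤ 1 := fun α => by
    induction α with
    | single t =>
      rw [hPF, ← h.balance]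
      simp only [AltSeq.dirac, inflow, add_zero]
      split_ifs <;> simp
    | snoc α a t ih =>
      rw [hPF, ← h.balance]
      simp only [AltSeq.dirac, reduceCtorEq, if_false, zero_add]
      refine (inflow_snoc_le Z α a t).trans (le_trans ?_ ih)
      rw [hPF]
      exact le_add_self
  have hP_top : ∀ α, P α ≠ ∞ := fun α => ne_top_of_le_ne_top ENNReal.one_ne_top (hP_le α)
  -- The choice at `α` is the conditional distribution of the mass leaving or stopping there. Where
  -- no mass arrives, stopping is an arbitrary default.
  set ch : AltSeq A.State Act → PMF (Option A.D) := fun α =>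
    if h0 : P α = 0 then PMF.pure none else PMF.normalize (F α) h0 (hP_top α) with hch
  have hmul : ∀ α o, P α * ch α o = F α o := fun α o => by
    by_cases h0 : P α = 0
    · rw [h0, zero_mul, eq_comm]
      exact ENNReal.tsum_eq_zero.1 h0 o
    · simp only [hch, dif_neg h0, PMF.normalize_apply]
      rw [mul_left_comm, ENNReal.mul_inv_cancel h0 (hP_top α), mul_one]
  let κ : A.toPA.Policy :=
    { choice := ch
      source_eq := fun α tr htr => by
        refine h.source_eq α tr fun hz => htr ?_
        by_cases h0 : P α = 0
        · simp [hch, h0]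
        · simp [hch, h0, PMF.normalize_apply, hF, hz] }
  have hcone : ∀ α, κ.cone s α = P α := fun α => by
    induction α with
    | single t =>
      rw [hPF, ← h.balance]
      simp [AltSeq.dirac, inflow, Policy.cone]
    | snoc α a t ih =>
      rw [hPF, ← h.balance]
      simp only [AltSeq.dirac, reduceCtorEq, if_false, zero_add, Policy.cone, ih, inflow,
        Policy.stepProb, ← ENNReal.tsum_mul_left]
      refine tsum_congr fun tr => ?_
      split_ifs
      · rw [← mul_assoc]
        exact congrArg (· * tgt tr t) (hmul α (some tr))
      · simp
  refine ⟨κ, ?_, ?_⟩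
  · funext α
    rw [Policy.haltProb, hcone]
    exact hmul α none
  · rw [← h.cost_eq]
    refine tsum_congr fun α => ?_
    rw [choiceCost, ← ENNReal.tsum_mul_left]
    refine tsum_congr fun tr => ?_
    rw [hcone, ← mul_assoc]
    exact congrArg (· * (A.cost tr : ℝ≥0∞)) (hmul α (some tr))

/-- Weak combined transitions in terms of flows. -/
theorem weakStep_of_flow {s : A.State} {w : List Act} {μ : PMF A.State} {c : ℝ≥0}
    {q : AltSeq A.State Act → ℝ≥0∞} (h : A.Flow (AltSeq.dirac (.single s)) q c)
    (hq : A.toPA.IsOutcome q w μ) : A.WeakStep s w μ c := by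
  obtain ⟨Z, hZ⟩ := h
  obtain ⟨κ, rfl, hc⟩ := hZ.exists_policy
  exact (weakStep_iff_policy s w μ c).2 ⟨κ, hq, hc⟩

/-- A weak combined transition can be performed after any sequence that ends in its source. -/
theorem WeakStep.exists_flow {β : AltSeq A.State Act} {w : List Act} {μ : PMF A.State} {c : ℝ≥0}
    (h : A.WeakStep β.last w μ c) :
    ∃ q, A.Flow β.dirac q c ∧ A.toPA.IsOutcome q (A.toPA.trace β ++ w) μ := by
  classical
  obtain ⟨κ, ho, hc⟩ := (weakStep_iff_policy _ w μ c).1 h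
  have hf := isFlow_of_policy κ β.last
  rw [hc] at hf
  refine ⟨β.push (κ.haltProb β.last), ⟨_, hf.push⟩, fun α hα => ?_, fun t => ?_⟩
  · obtain ⟨γ, rfl, hγ⟩ := AltSeq.exists_of_push_ne_zero hα
    rw [trace_append, ho.trace_eq γ hγ]
  · rw [← ho.last_eq]
    have h1 := AltSeq.tsum_push_mul β (κ.haltProb β.last) fun α => if α.last = t then 1 else 0
    simp only [mul_ite, mul_one, mul_zero] at h1
    refine h1.trans (tsum_congr fun γ => ?_)
    cases γ with
    | single x =>
      by_cases h0 : κ.haltProb β.last (.single x) = 0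
      · simp [h0]
      · have : x = β.last := hf.eq_of_single_ne_zero fun hz => h0 (add_eq_zero.1 hz).1
        subst this
        rfl
    | snoc γ a x => rfl

end CPA

/-! ### Simulation of weak combined transitions -/

namespace CPA

open PA

variable {Act : Type u} {A B : CPA.{u, v} Act}

/-- The relation `R` is a weak simulation: every transition is matched by a weak combined
transition with the same trace and the same cost. -/
def IsWeakSimulation (A B : CPA.{u, v} Act) (R : A.State → B.State → Prop) : Prop :=
  ∀ s t, R s t → ∀ w c μ, A.Step s w μ c → ∃ ν, B.WeakStep t w ν c ∧ LiftRel R μ ν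

/-- The function `K` distributes the mass that matches the transition `tr` after `β` over the
target states of `tr`. -/
structure IsMatching (R : A.State → B.State → Prop) (tr : A.D) (β : AltSeq B.State Act)
    (K : A.State → AltSeq B.State Act → ℝ≥0∞) : Prop where
  flow : B.Flow β.dirac (fun γ => ∑' x, K x γ) (A.cost tr)
  tsum_eq : ∀ x, ∑' γ, K x γ = tgt tr x
  rel : ∀ x γ, K x γ ≠ 0 → R x γ.last
  trace_eq : ∀ x γ, K x γ ≠ 0 →
    B.toPA.trace γ = B.toPA.trace β ++ A.toPA.actTrace (act tr)

/-- The outcome `q` of the matching weak transition is disintegrated along the coupling `W`: the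
mass at `γ` is shared among the states `x` in the proportions `W x γ.last / ν γ.last`. -/
theorem IsWeakSimulation.exists_isMatching {R : A.State → B.State → Prop}
    (hR : IsWeakSimulation A B R) {tr : A.D} {β : AltSeq B.State Act} (h : R (src tr) β.last) :
    ∃ K, IsMatching R tr β K := by
  obtain ⟨ν, hν, W, hWR, hW1, hW2⟩ := hR _ _ h _ _ _ ⟨tr, rfl, rfl, rfl, rfl⟩
  obtain ⟨q, hq, ho⟩ := hν.exists_flow
  have hqν : ∀ γ, q γ ≠ 0 → ν γ.last ≠ 0 := fun γ hγ h0 => by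
    rw [← ho.last_eq] at h0
    exact hγ (le_antisymm (h0 ▸ le_lastMass q γ) zero_le)
  have hdiv : ∀ γ, ∑' x, q γ * (W x γ.last / ν γ.last) = q γ := fun γ => by
    simp only [div_eq_mul_inv]
    rw [ENNReal.tsum_mul_left, ENNReal.tsum_mul_right, hW2]
    by_cases h0 : q γ = 0
    · simp [h0]
    · rw [ENNReal.mul_inv_cancel (hqν γ h0) (PMF.apply_ne_top _ _), mul_one]
  refine ⟨fun x γ => q γ * (W x γ.last / ν γ.last), ?_, fun x => ?_, fun x γ hγ => ?_,
    fun x γ hγ => ho.trace_eq γ (left_ne_zero_of_mul hγ)⟩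
  · simpa only [hdiv] using hq
  · rw [tsum_mul_last q fun t => W x t / ν t, ← hW1 x]
    refine tsum_congr fun t => ?_
    rw [ho.last_eq]
    by_cases h0 : ν t = 0
    · have h1 : W x t ≤ ν t := by
        rw [← hW2]
        exact ENNReal.le_tsum (f := fun x => W x t) x
      rw [h0] at h1
      rw [h0, zero_mul, eq_comm]
      exact le_antisymm h1 zero_le
    · exact ENNReal.mul_div_cancel h0 (PMF.apply_ne_top _ _)
  · refine hWR x _ (pos_iff_ne_zero.2 fun h0 => hγ ?_)
    simp [h0]

section Simulate

variable (κ : A.toPA.Policy) (s : A.State) (t : B.State)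
  (K : A.D → AltSeq B.State Act → A.State → AltSeq B.State Act → ℝ≥0∞)

open scoped Classical in
/-- The joint mass of the executions of the policy `κ` from `s` and the executions from `t` that
simulate them by means of the kernels `K`. -/
noncomputable def jointMass : AltSeq A.State Act → AltSeq B.State Act → ℝ≥0∞
  | .single x, β => if x = s then AltSeq.dirac (.single t) β else 0
  | .snoc α a x, γ => ∑' β, ∑' tr : A.D, if act tr = a then
      jointMass α β * κ.choice α (some tr) * K tr β x γ else 0

variable {κ s t K} {R : A.State → B.State → Prop}
-- The invariant of the simulation. The kernels `K tr β` are only controlled when `R (src tr)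
-- β.last` holds, and this guarantees it wherever there is mass.
theorem rel_of_jointMass_ne_zero
    (hK : ∀ tr β, R (src tr) β.last → IsMatching R tr β (K tr β)) (hst : R s t)
    {α : AltSeq A.State Act} {β : AltSeq B.State Act}
    (h : jointMass κ s t K α β ≠ 0) :
    R α.last β.last ∧ B.toPA.trace β = A.toPA.trace α := by
  classical
  induction α generalizing β with
  | single x =>
    simp only [jointMass, AltSeq.dirac] at h
    split_ifs at h with h1 h2
    · subst h1 h2
      exact ⟨hst, rfl⟩
    · exact absurd rfl h
    · exact absurd rfl h
  | snoc α a x ih =>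
    obtain ⟨γ, hγ⟩ : ∃ γ, (∑' tr : A.D, if act tr = a then
        jointMass κ s t K α γ * κ.choice α (some tr) * K tr γ x β else 0) ≠ 0 := by
      by_contra! hc
      exact h (ENNReal.tsum_eq_zero.2 hc)
    obtain ⟨tr, htr⟩ : ∃ tr : A.D, (if act tr = a then
        jointMass κ s t K α γ * κ.choice α (some tr) * K tr γ x β else 0) ≠ 0 := by
      by_contra! hc
      exact hγ (ENNReal.tsum_eq_zero.2 hc)
    split_ifs at htr with ha
    · have h1 := left_ne_zero_of_mul htr
      obtain ⟨h2, h3⟩ := ih (left_ne_zero_of_mul h1)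
      have hm := hK tr γ (by rwa [κ.source_eq α tr (right_ne_zero_of_mul h1)])
      refine ⟨hm.rel x β (right_ne_zero_of_mul htr), ?_⟩
      rw [hm.trace_eq x β (right_ne_zero_of_mul htr), h3, ha]
      rfl
    · exact absurd rfl htr

theorem isMatching_of_mul_ne_zero
    (hK : ∀ tr β, R (src tr) β.last → IsMatching R tr β (K tr β)) (hst : R s t)
    {α : AltSeq A.State Act} {β : AltSeq B.State Act} {tr : A.D}
    (h : jointMass κ s t K α β * κ.choice α (some tr) ≠ 0) : IsMatching R tr β (K tr β) := by
  refine hK tr β ?_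
  rw [κ.source_eq α tr (right_ne_zero_of_mul h)]
  exact (rel_of_jointMass_ne_zero hK hst (left_ne_zero_of_mul h)).1

/-- Each kernel has marginal `tgt tr` on the states of `A`, so summing out the simulating execution
recovers the simulated one. -/
theorem tsum_jointMass
    (hK : ∀ tr β, R (src tr) β.last → IsMatching R tr β (K tr β)) (hst : R s t)
    (α : AltSeq A.State Act) :
    ∑' β, jointMass κ s t K α β = κ.cone s α := by
  classical
  induction α with
  | single x =>
    by_cases hx : x = s
    · simp only [jointMass, hx, if_true, AltSeq.dirac, Policy.cone]
      exact tsum_ite_eq _ _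
    · simp [jointMass, hx, Policy.cone]
  | snoc α a x ih =>
    simp only [jointMass, Policy.cone, Policy.stepProb]
    rw [← ih, ← ENNReal.tsum_mul_right, ENNReal.tsum_comm]
    refine tsum_congr fun β => ?_
    rw [ENNReal.tsum_comm, ← ENNReal.tsum_mul_left]
    refine tsum_congr fun tr => ?_
    split_ifs
    · rw [ENNReal.tsum_mul_left, ← mul_assoc]
      by_cases h0 : jointMass κ s t K α β * κ.choice α (some tr) = 0
      · simp [h0]
      · rw [(isMatching_of_mul_ne_zero hK hst h0).tsum_eq]
    · simp

theorem levelSum_jointMass_succ (n : ℕ) (γ : AltSeq B.State Act) :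
    AltSeq.levelSum (n + 1) (fun α => jointMass κ s t K α γ) =
      AltSeq.levelSum n fun α => ∑' β, ∑' tr,
        jointMass κ s t K α β * κ.choice α (some tr) * ∑' x, K tr β x γ := by
  classical
  rw [AltSeq.levelSum_succ]
  refine AltSeq.levelSum_congr fun α _ => ?_
  simp only [jointMass]
  calc _ = ∑' a, ∑' β, ∑' x, ∑' tr : A.D, (if act tr = a then
          jointMass κ s t K α β * κ.choice α (some tr) * K tr β x γ else 0) :=
        tsum_congr fun a => ENNReal.tsum_comm
    _ = ∑' β, ∑' a, ∑' x, ∑' tr : A.D, (if act tr = a then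
          jointMass κ s t K α β * κ.choice α (some tr) * K tr β x γ else 0) := ENNReal.tsum_comm
    _ = _ := by
      refine tsum_congr fun β => ?_
      rw [tsum_act (A := A.toPA)]
      simp_rw [ENNReal.tsum_mul_left]

/-- The flow that matches the transitions chosen at time `n`. -/
theorem flow_levelSum_jointMass
    (hK : ∀ tr β, R (src tr) β.last → IsMatching R tr β (K tr β)) (hst : R s t)
    (n : ℕ) :
    B.Flow (fun γ => AltSeq.levelSum n fun α => jointMass κ s t K α γ)
      (fun γ => AltSeq.levelSum n (fun α => jointMass κ s t K α γ * κ.choice α none) +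
        AltSeq.levelSum (n + 1) fun α => jointMass κ s t K α γ)
      (AltSeq.levelSum n fun α => κ.cone s α * choiceCost κ α) := by
  classical
  -- The flow is an average over a simulated sequence, a simulating sequence and a choice. The
  -- choice `none` leaves the mass in place at cost `0`; the choice `tr` runs its matching flow.
  let k : AltSeq A.State Act × AltSeq B.State Act × Option A.D → ℝ≥0∞ := fun i =>
    if i.1.length = n then jointMass κ s t K i.1 i.2.1 * κ.choice i.1 i.2.2 else 0
  let q : AltSeq A.State Act × AltSeq B.State Act × Option A.D → AltSeq B.State Act → ℝ≥0∞ :=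
    fun i γ => i.2.2.elim (i.2.1.dirac γ) fun tr => ∑' x, K tr i.2.1 x γ
  let c : AltSeq A.State Act × AltSeq B.State Act × Option A.D → ℝ≥0∞ :=
    fun i => i.2.2.elim 0 fun tr => (A.cost tr : ℝ≥0∞)
  have hflow : ∀ i, k i ≠ 0 → B.Flow i.2.1.dirac (q i) (c i) := by
    rintro ⟨α, β, o⟩ hi
    simp only [k] at hi
    split_ifs at hi with hα
    · cases o with
      | none => exact Flow.refl _
      | some tr => exact (isMatching_of_mul_ne_zero hK hst hi).flow
    · exact absurd rfl hi
  have hsum : ∀ f : AltSeq B.State Act → Option A.D → ℝ≥0∞,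
      ∑' i, k i * f i.2.1 i.2.2 = AltSeq.levelSum n fun α =>
        ∑' β, jointMass κ s t K α β * (κ.choice α none * f β none +
          ∑' tr, κ.choice α (some tr) * f β (some tr)) := fun f => by
    rw [ENNReal.tsum_prod', AltSeq.levelSum]
    refine tsum_congr fun α => ?_
    rw [ENNReal.tsum_prod']
    simp only [k]
    split_ifs
    · refine tsum_congr fun β => ?_
      rw [ENNReal.tsum_option, mul_add, ← ENNReal.tsum_mul_left, mul_assoc]
      simp_rw [mul_assoc]
    · simp
  have hdirac : ∀ (F : AltSeq B.State Act → ℝ≥0∞) γ, ∑' β, F β * AltSeq.dirac β γ = F γ := by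
    intro F γ
    rw [tsum_eq_single γ fun β hβ => by simp [AltSeq.dirac, hβ.symm]]
    simp [AltSeq.dirac]
  have h := Flow.tsum hflow
  convert h using 1
  · funext γ
    rw [hsum fun β _ => β.dirac γ]
    refine AltSeq.levelSum_congr fun α _ => ?_
    simp_rw [ENNReal.tsum_mul_right, ← add_mul, κ.choice_none_add, one_mul, hdirac]
  · funext γ
    refine Eq.trans ?_ (hsum fun β o => o.elim (β.dirac γ) fun tr => ∑' x, K tr β x γ).symm
    rw [levelSum_jointMass_succ, ← AltSeq.levelSum_add]
    refine AltSeq.levelSum_congr fun α _ => ?_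
    simp only [Option.elim, mul_add, ENNReal.tsum_add, ← mul_assoc, ← ENNReal.tsum_mul_left]
    rw [hdirac fun β => jointMass κ s t K α β * κ.choice α none]
  · refine Eq.trans ?_ (hsum fun β o => o.elim 0 fun tr => (A.cost tr : ℝ≥0∞)).symm
    refine AltSeq.levelSum_congr fun α _ => ?_
    simp only [Option.elim, mul_zero, zero_add, ENNReal.tsum_mul_right]
    rw [tsum_jointMass hK hst]
    rfl

end Simulate

/-- A weak simulation matches weak combined transitions as well. -/
theorem IsWeakSimulation.weakStep {R : A.State → B.State → Prop} (hR : IsWeakSimulation A B R)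
    {s : A.State} {t : B.State} (hst : R s t) {w : List Act} {c : ℝ≥0} {μ : PMF A.State}
    (h : A.WeakStep s w μ c) : ∃ ν, B.WeakStep t w ν c ∧ LiftRel R μ ν := by
  classical
  obtain ⟨κ, ho, hc⟩ := (weakStep_iff_policy s w μ c).1 h
  have hK : ∀ tr β, ∃ K, R (src tr) β.last → IsMatching (A := A) (B := B) R tr β K :=
      fun tr β => by
    by_cases hr : R (src tr) β.last
    · obtain ⟨K, hK⟩ := hR.exists_isMatching hr
      exact ⟨K, fun _ => hK⟩
    · exact ⟨fun _ _ => 0, fun h => absurd h hr⟩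
  choose K hK using hK
  set g := jointMass κ s t K with hg
  set q : AltSeq B.State Act → ℝ≥0∞ := fun γ => ∑' α, g α γ * κ.choice α none with hq
  have hflow : B.Flow (AltSeq.dirac (.single t)) q c := by
    -- The mass in transit at time `n` is at most the probability that `κ` takes at least `n` steps.
    -- The costs of the stages add up to the cost of `κ`.
    have h1 := Flow.iterate (fun n => flow_levelSum_jointMass hK hst n) (fun γ => by
      refine tendsto_of_tendsto_of_tendsto_of_le_of_le tendsto_const_nhds
        (κ.tendsto_levelSum_cone ho.tsum_eq_one) (fun _ => zero_le) fun n => ?_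
      refine AltSeq.levelSum_mono fun α _ => ?_
      rw [← tsum_jointMass hK hst]
      exact ENNReal.le_tsum γ)
    simp only [AltSeq.tsum_levelSum, hc, AltSeq.levelSum_zero] at h1
    convert h1 using 1
    funext γ
    exact (tsum_ite_eq s fun _ => AltSeq.dirac (.single t) γ).symm
  have hhalt : ∀ α, ∑' γ, g α γ * κ.choice α none = κ.haltProb s α := fun α => by
    rw [ENNReal.tsum_mul_right, hg, tsum_jointMass hK hst]
    rfl
  have hq1 : ∑' γ, q γ = 1 := by
    rw [hq, ENNReal.tsum_comm, tsum_congr hhalt, ho.tsum_eq_one]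
  let ν : PMF B.State := ⟨lastMass q, by
    rw [← hq1, ← tsum_lastMass]
    exact ENNReal.summable.hasSum⟩
  -- The coupling is the joint law of the two last states at the moment when `κ` stops.
  refine ⟨ν, weakStep_of_flow hflow ⟨fun γ hγ => ?_, fun _ => rfl⟩,
    fun x y => ∑' α, ∑' γ, if α.last = x ∧ γ.last = y then g α γ * κ.choice α none else 0,
    fun x y hxy => ?_, fun x => ?_, fun y => ?_⟩
  · obtain ⟨α, hα⟩ : ∃ α, g α γ * κ.choice α none ≠ 0 := by
      by_contra! hc
      exact hγ (ENNReal.tsum_eq_zero.2 hc)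
    rw [(rel_of_jointMass_ne_zero hK hst (left_ne_zero_of_mul hα)).2]
    refine ho.trace_eq α fun h0 => hα ?_
    rw [← hhalt] at h0
    exact ENNReal.tsum_eq_zero.1 h0 γ
  · obtain ⟨α, hα⟩ : ∃ α, (∑' γ, if α.last = x ∧ γ.last = y then
        g α γ * κ.choice α none else 0) ≠ 0 := by
      by_contra! hc
      exact hxy.ne' (ENNReal.tsum_eq_zero.2 hc)
    obtain ⟨γ, hγ⟩ : ∃ γ : AltSeq B.State Act, (if α.last = x ∧ γ.last = y then
        g α γ * κ.choice α none else 0) ≠ 0 := by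
      by_contra! hc
      exact hα (ENNReal.tsum_eq_zero.2 hc)
    split_ifs at hγ with hl
    · rw [← hl.1, ← hl.2]
      exact (rel_of_jointMass_ne_zero hK hst (left_ne_zero_of_mul hγ)).1
    · exact absurd rfl hγ
  · rw [← ho.last_eq, lastMass, ENNReal.tsum_comm]
    refine tsum_congr fun α => ?_
    rw [ENNReal.tsum_comm]
    by_cases hα : α.last = x
    · simp only [hα, true_and, if_true]
      rw [← hhalt]
      refine tsum_congr fun γ => ?_
      simp_rw [eq_comm (a := γ.last)]
      exact tsum_ite_eq _ _
    · simp [hα]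
  · change _ = lastMass q y
    rw [lastMass, ENNReal.tsum_comm]
    calc _ = ∑' α, ∑' γ, if γ.last = y then g α γ * κ.choice α none else 0 := by
          refine tsum_congr fun α => ?_
          rw [tsum_eq_single α.last fun x hx => by simp [hx.symm]]
          simp
      _ = _ := by
          rw [ENNReal.tsum_comm]
          refine tsum_congr fun γ => ?_
          split_ifs <;> simp [hq]

end CPA

/-! ### Common quotients and the equivalence relation -/

namespace CPA

open PA

variable {Act : Type u}

/-- A transition is a weak combined transition. -/
theorem Step.weakStep {A : CPA.{u, v} Act} {s : A.State} {w : List Act} {μ : PMF A.State} {c : ℝ≥0}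
    (h : A.Step s w μ c) : A.WeakStep s w μ c := by
  classical
  obtain ⟨tr, rfl, rfl, rfl, rfl⟩ := h
  -- One unit of mass moves along `tr` and then stops, so the outcome is the inflow itself.
  let Z : AltSeq A.State Act → A.D → ℝ≥0∞ := fun α tr' =>
    if α = .single (src tr) ∧ tr' = tr then 1 else 0
  have hin : ∀ α a t, inflow (A := A.toPA) Z (.snoc α a t) =
      if α = .single (src tr) ∧ a = act tr then tgt tr t else 0 := fun α a t => by
    rw [inflow, tsum_eq_single tr fun tr' htr' => by simp [Z, htr']]
    by_cases h1 : α = .single (src tr) <;> simp [Z, h1, eq_comm (a := a)]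
  refine weakStep_of_flow (q := inflow (A := A.toPA) Z) ⟨Z, ?_, fun α => ?_, ?_⟩
    ⟨fun α hα => ?_, fun t => ?_⟩
  · intro α tr' h'
    simp only [Z] at h'
    split_ifs at h' with hc
    · rw [hc.1, hc.2]
      rfl
    · exact absurd rfl h'
  · rw [add_comm, tsum_eq_single tr fun tr' htr' => by simp [Z, htr']]
    simp [Z, AltSeq.dirac]
  · rw [tsum_eq_single (.single (src tr)) fun α hα => by simp [Z, hα],
      tsum_eq_single tr fun tr' htr' => by simp [Z, htr']]
    simp [Z]
  · cases α with
    | single t => exact absurd rfl hα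
    | snoc α a t =>
      rw [hin] at hα
      split_ifs at hα with hc
      · simp [trace, hc.1, hc.2]
      · exact absurd rfl hα
  · have h0 : ∑' x, (if (AltSeq.single x : AltSeq A.State Act).last = t then
        inflow (A := A.toPA) Z (.single x) else 0) = 0 :=
      ENNReal.tsum_eq_zero.2 fun x => by simp [inflow]
    rw [lastMass, AltSeq.tsum_eq, h0, zero_add]
    simp only [hin]
    rw [tsum_eq_single (.single (src tr)) fun α hα => by simp [hα],
      tsum_eq_single (act tr) fun a ha => by simp [ha],
      tsum_eq_single t fun x hx => by simp [AltSeq.last, hx]]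
    simp [AltSeq.last]

/-- For the relation of having the same image, the lifting is equality of the image
distributions. -/
theorem liftRel_iff_map_eq {X Y Z : Type v} (h : X → Z) (k : Y → Z) (μ : PMF X) (ν : PMF Y) :
    LiftRel (fun x y => h x = k y) μ ν ↔ μ.map h = ν.map k := by
  classical
  constructor
  · rintro ⟨w, hw, h1, h2⟩
    ext z
    rw [PMF.map_apply, PMF.map_apply]
    calc _ = ∑' x, ∑' y, (if z = h x then w x y else 0) := by
          refine tsum_congr fun x => ?_
          split_ifs <;> simp [h1]
      _ = ∑' x, ∑' y, (if z = k y then w x y else 0) := by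
          refine tsum_congr fun x => tsum_congr fun y => ?_
          by_cases h0 : w x y = 0
          · simp [h0]
          · rw [hw x y (pos_iff_ne_zero.2 h0)]
      _ = ∑' y, ∑' x, (if z = k y then w x y else 0) := ENNReal.tsum_comm
      _ = _ := by
          refine tsum_congr fun y => ?_
          split_ifs <;> simp [h2]
  · intro hρ
    have hle : ∀ {X : Type v} (h : X → Z) (μ : PMF X) x, μ x ≤ μ.map h (h x) := by
      intro X h μ x
      rw [PMF.map_apply]
      refine le_trans ?_ (ENNReal.le_tsum x)
      simp
    have hdiv : ∀ {X : Type v} (h : X → Z) (μ : PMF X) x,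
        μ x * (μ.map h (h x) / μ.map h (h x)) = μ x := by
      intro X h μ x
      by_cases h0 : μ.map h (h x) = 0
      · have := hle h μ x
        rw [h0] at this
        rw [le_antisymm this zero_le, zero_mul]
      · rw [ENNReal.div_self h0 (PMF.apply_ne_top _ _), mul_one]
    -- The coupling draws `x` and `y` independently, conditionally on their common image.
    refine ⟨fun x y => if h x = k y then μ x * ν y / μ.map h (h x) else 0, fun x y hxy => ?_,
      fun x => ?_, fun y => ?_⟩
    · by_contra hc
      simp [hc] at hxy
    · conv_rhs => rw [← hdiv h μ x]
      conv_rhs => enter [2, 1]; rw [hρ, PMF.map_apply]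
      rw [div_eq_mul_inv, ← ENNReal.tsum_mul_right, ← ENNReal.tsum_mul_left]
      refine tsum_congr fun y => ?_
      beta_reduce
      split_ifs
      · rw [div_eq_mul_inv, mul_assoc]
      · simp
    · conv_rhs => rw [← hdiv k ν y]
      conv_rhs => enter [2, 1]; rw [← hρ, PMF.map_apply]
      rw [div_eq_mul_inv, ← ENNReal.tsum_mul_right, ← ENNReal.tsum_mul_left]
      refine tsum_congr fun x => ?_
      beta_reduce
      by_cases hxy : h x = k y
      · rw [if_pos hxy, if_pos hxy.symm, div_eq_mul_inv, hxy, hρ, mul_comm (μ x), mul_assoc]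
      · rw [if_neg hxy, if_neg (Ne.symm hxy)]
        simp

/-- There is a weak combined transition from `s` whose target distribution has image `ρ` under
`h`. -/
def ImageWeakStep (A : CPA.{u, v} Act) {Z : Type v} (h : A.State → Z) (s : A.State) (w : List Act)
    (c : ℝ≥0) (ρ : PMF Z) : Prop :=
  ∃ μ, A.WeakStep s w μ c ∧ μ.map h = ρ

/-- The states of `B` with the same image in `Z` match the weak combined transitions of `A`, up to
images of distributions. -/
def ImageSimulates {Z : Type v} (A B : CPA.{u, v} Act) (h : A.State → Z) (k : B.State → Z) : Prop :=
  ∀ s t, h s = k t → ∀ w c ρ, A.ImageWeakStep h s w c ρ → B.ImageWeakStep k t w c ρ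

/-- This puts weak transitions on both the challenging and the matching side, so that matchings
compose. Single transitions are weak ones; the converse direction is `IsWeakSimulation.weakStep`. -/
theorem imageSimulates_iff {Z : Type v} {A B : CPA.{u, v} Act} {h : A.State → Z} {k : B.State → Z} :
    ImageSimulates A B h k ↔ IsWeakSimulation A B fun s t => h s = k t := by
  constructor
  · intro H s t hst w c μ hμ
    obtain ⟨ν, hν, he⟩ := H s t hst w c _ ⟨μ, hμ.weakStep, rfl⟩
    exact ⟨ν, hν, (liftRel_iff_map_eq h k μ ν).2 he.symm⟩
  · rintro H s t hst w c _ ⟨μ, hμ, rfl⟩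
    obtain ⟨ν, hν, he⟩ := H.weakStep hst hμ
    exact ⟨ν, hν, ((liftRel_iff_map_eq h k μ ν).1 he).symm⟩

theorem ImageWeakStep.comp {A : CPA.{u, v} Act} {Y Z : Type v} {h : A.State → Y} {s : A.State}
    {w : List Act} {c : ℝ≥0} {ρ : PMF Y} (H : A.ImageWeakStep h s w c ρ) (f : Y → Z) :
    A.ImageWeakStep (f ∘ h) s w c (ρ.map f) := by
  obtain ⟨μ, hμ, rfl⟩ := H
  exact ⟨μ, hμ, (PMF.map_comp h μ f).symm⟩

/-- Targets may be compared in a coarser quotient as long as the sources agree in the finer one; the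
gluing below needs this. -/
theorem ImageSimulates.comp_apply {A B : CPA.{u, v} Act} {Y Z : Type v} {h : A.State → Y}
    {k : B.State → Y} (H : ImageSimulates A B h k) (f : Y → Z) {s : A.State} {t : B.State}
    (hst : h s = k t) {w : List Act} {c : ℝ≥0} {ρ : PMF Z}
    (hs : A.ImageWeakStep (f ∘ h) s w c ρ) : B.ImageWeakStep (f ∘ k) t w c ρ := by
  obtain ⟨μ, hμ, rfl⟩ := hs
  rw [← PMF.map_comp]
  exact (H s t hst w c _ ⟨μ, hμ, rfl⟩).comp f

/-- The maps `h` and `k` identify states such that states with the same image match each other. -/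
structure IsCommonQuotient {Z : Type v} (A B : CPA.{u, v} Act) (h : A.State → Z)
    (k : B.State → Z) : Prop where
  left_left : ImageSimulates A A h h
  left_right : ImageSimulates A B h k
  right_left : ImageSimulates B A k h
  right_right : ImageSimulates B B k k

theorem IsCommonQuotient.symm {Z : Type v} {A B : CPA.{u, v} Act} {h : A.State → Z}
    {k : B.State → Z} (H : IsCommonQuotient A B h k) : IsCommonQuotient B A k h :=
  ⟨H.right_right, H.right_left, H.left_right, H.left_left⟩

/-- An equivalence relation on the disjoint union is a bisimulation if and only if the maps to the
quotient form a common quotient. -/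
theorem isWeakCostBisimulation_iff {A B : CPA.{u, v} Act} {R : Setoid (A.State ⊕ B.State)}
    {Z : Type v} {f : A.State ⊕ B.State → Z} (hf : ∀ x y, R x y ↔ f x = f y) :
    IsWeakCostBisimulation A B R ↔ IsCommonQuotient A B (f ∘ Sum.inl) (f ∘ Sum.inr) := by
  have hlift : ∀ {X Y : Type v} (i : X → A.State ⊕ B.State) (j : Y → A.State ⊕ B.State)
      (μ : PMF X) (ν : PMF Y), LiftRel R (μ.map i) (ν.map j) ↔
        LiftRel (fun x y => (f ∘ i) x = (f ∘ j) y) μ ν := by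
    intro X Y i j μ ν
    have hR : (R : A.State ⊕ B.State → A.State ⊕ B.State → Prop) = fun x y => f x = f y := by
      funext x y
      exact propext (hf x y)
    rw [hR, liftRel_iff_map_eq, liftRel_iff_map_eq, PMF.map_comp, PMF.map_comp]
  constructor
  · intro H
    refine ⟨imageSimulates_iff.2 ?_, imageSimulates_iff.2 ?_, imageSimulates_iff.2 ?_,
      imageSimulates_iff.2 ?_⟩
    all_goals
      intro s t hst w c μ hμ
      obtain ⟨_, ⟨ν, hν, rfl⟩, hl⟩ := H _ _ ((hf _ _).2 hst) w c _ ⟨μ, hμ, rfl⟩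
      exact ⟨ν, hν, (hlift _ _ μ ν).1 hl⟩
  · rintro ⟨h1, h2, h3, h4⟩
    rw [imageSimulates_iff] at h1 h2 h3 h4
    rintro (s | s) (t | t) hst w c _ ⟨μ, hμ, rfl⟩
    · obtain ⟨ν, hν, hl⟩ := h1 s t ((hf _ _).1 hst) w c μ hμ
      exact ⟨_, ⟨ν, hν, rfl⟩, (hlift _ _ μ ν).2 hl⟩
    · obtain ⟨ν, hν, hl⟩ := h2 s t ((hf _ _).1 hst) w c μ hμ
      exact ⟨_, ⟨ν, hν, rfl⟩, (hlift _ _ μ ν).2 hl⟩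
    · obtain ⟨ν, hν, hl⟩ := h3 s t ((hf _ _).1 hst) w c μ hμ
      exact ⟨_, ⟨ν, hν, rfl⟩, (hlift _ _ μ ν).2 hl⟩
    · obtain ⟨ν, hν, hl⟩ := h4 s t ((hf _ _).1 hst) w c μ hμ
      exact ⟨_, ⟨ν, hν, rfl⟩, (hlift _ _ μ ν).2 hl⟩

/-- Maps into an arbitrary set `Z` can be composed and glued, unlike relations tied to one
particular disjoint union. -/
theorem weakCostBisimilar_iff {A B : CPA.{u, v} Act} :
    WeakCostBisimilar A B ↔ ∃ (Z : Type v) (h : A.State → Z) (k : B.State → Z),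
      IsCommonQuotient A B h k ∧ h A.start = k B.start := by
  constructor
  · rintro ⟨R, hR, hs⟩
    exact ⟨Quotient R, _, _,
      (isWeakCostBisimulation_iff (f := Quotient.mk R) fun x y => Quotient.eq.symm).1 hR,
      Quotient.sound hs⟩
  · rintro ⟨Z, h, k, H, hs⟩
    exact ⟨Setoid.ker (Sum.elim h k),
      (isWeakCostBisimulation_iff (f := Sum.elim h k) fun x y => Iff.rfl).2 H, hs⟩

theorem WeakCostBisimilar.refl (A : CPA.{u, v} Act) : WeakCostBisimilar A A := by
  have h : ImageSimulates A A id id := by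
    rintro s _ rfl w c ρ hρ
    exact hρ
  exact weakCostBisimilar_iff.2 ⟨A.State, id, id, ⟨h, h, h, h⟩, rfl⟩

theorem WeakCostBisimilar.symm {A B : CPA.{u, v} Act} (H : WeakCostBisimilar A B) :
    WeakCostBisimilar B A := by
  obtain ⟨Z, h, k, H, hs⟩ := weakCostBisimilar_iff.1 H
  exact weakCostBisimilar_iff.2 ⟨Z, k, h, H.symm, hs.symm⟩

/-- Some state of `A` or `B` over `z` has a weak combined transition whose target distribution
has image `ρ` under `f`. -/
def StepOver {Y Z : Type v} (A B : CPA.{u, v} Act) (h : A.State → Y) (k : B.State → Y) (f : Y → Z)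
    (z : Y) (w : List Act) (c : ℝ≥0) (ρ : PMF Z) : Prop :=
  (∃ s, h s = z ∧ A.ImageWeakStep (f ∘ h) s w c ρ) ∨ ∃ t, k t = z ∧ B.ImageWeakStep (f ∘ k) t w c ρ

namespace IsCommonQuotient

variable {Y Z : Type v} {A B : CPA.{u, v} Act} {h : A.State → Y} {k : B.State → Y}

/-- States over one point match each other, so any one of them decides `StepOver`. -/
theorem stepOver_left_iff (H : IsCommonQuotient A B h k) (f : Y → Z) (s : A.State) (w : List Act)
    (c : ℝ≥0) (ρ : PMF Z) :
    StepOver A B h k f (h s) w c ρ ↔ A.ImageWeakStep (f ∘ h) s w c ρ := by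
  constructor
  · rintro (⟨s', hs, hs'⟩ | ⟨t, ht, ht'⟩)
    · exact H.left_left.comp_apply f hs hs'
    · exact H.right_left.comp_apply f ht ht'
  · exact fun hs => Or.inl ⟨s, rfl, hs⟩

theorem stepOver_right_iff (H : IsCommonQuotient A B h k) (f : Y → Z) (t : B.State) (w : List Act)
    (c : ℝ≥0) (ρ : PMF Z) :
    StepOver A B h k f (k t) w c ρ ↔ B.ImageWeakStep (f ∘ k) t w c ρ := by
  constructor
  · rintro (⟨s, hs, hs'⟩ | ⟨t', ht, ht'⟩)
    · exact H.left_right.comp_apply f hs hs'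
    · exact H.right_right.comp_apply f ht ht'
  · exact fun ht => Or.inr ⟨t, rfl, ht⟩

end IsCommonQuotient

theorem WeakCostBisimilar.trans {A B C : CPA.{u, v} Act} (H₁ : WeakCostBisimilar A B)
    (H₂ : WeakCostBisimilar B C) : WeakCostBisimilar A C := by
  obtain ⟨Y₁, h₁, k₁, H₁, hs₁⟩ := weakCostBisimilar_iff.1 H₁
  obtain ⟨Y₂, h₂, k₂, H₂, hs₂⟩ := weakCostBisimilar_iff.1 H₂
  -- `Quot r` is the pushout of `Y₁` and `Y₂` over the states of `B`.
  let r : Y₁ ⊕ Y₂ → Y₁ ⊕ Y₂ → Prop := fun x y => ∃ b, x = .inl (k₁ b) ∧ y = .inr (h₂ b)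
  let f₁ : Y₁ → Quot r := fun y => Quot.mk r (.inl y)
  let f₂ : Y₂ → Quot r := fun y => Quot.mk r (.inr y)
  have hglue : f₁ ∘ k₁ = f₂ ∘ h₂ := funext fun b => Quot.sound ⟨b, rfl, rfl⟩
  -- The invariant that descends to the pushout, with targets already compared there. It only has to
  -- be checked on the generators of `r`, where both sides describe the weak transitions of the same
  -- `b`; this replaces an induction along chains of identifications.
  let Q : Quot r → List Act → ℝ≥0 → PMF (Quot r) → Prop :=
    Quot.lift (Sum.elim (StepOver A B h₁ k₁ f₁) (StepOver B C h₂ k₂ f₂)) (by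
      rintro _ _ ⟨b, rfl, rfl⟩
      funext w c ρ
      refine propext ((H₁.stepOver_right_iff f₁ b w c ρ).trans ?_)
      rw [hglue]
      exact (H₂.stepOver_left_iff f₂ b w c ρ).symm)
  have hA : ∀ s w c ρ, Q ((f₁ ∘ h₁) s) w c ρ ↔ A.ImageWeakStep (f₁ ∘ h₁) s w c ρ :=
    H₁.stepOver_left_iff f₁
  have hC : ∀ t w c ρ, Q ((f₂ ∘ k₂) t) w c ρ ↔ C.ImageWeakStep (f₂ ∘ k₂) t w c ρ :=
    H₂.stepOver_right_iff f₂
  refine weakCostBisimilar_iff.2 ⟨Quot r, f₁ ∘ h₁, f₂ ∘ k₂, ⟨?_, ?_, ?_, ?_⟩, ?_⟩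
  · intro s t hst w c ρ
    rw [← hA, ← hA, hst]
    exact id
  · intro s t hst w c ρ
    rw [← hA, ← hC, hst]
    exact id
  · intro s t hst w c ρ
    rw [← hC, ← hA, hst]
    exact id
  · intro s t hst w c ρ
    rw [← hC, ← hC, hst]
    exact id
  · simp only [Function.comp_apply, hs₁, ← hs₂]
    exact congrFun hglue B.start

end CPA

theorem mainTheorem4 {Act : Type u} :
    Equivalence (CPA.WeakCostBisimilar : CPA.{u, v} Act → CPA.{u, v} Act → Prop) :=
  ⟨CPA.WeakCostBisimilar.refl, CPA.WeakCostBisimilar.symm, CPA.WeakCostBisimilar.trans⟩
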